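/- Let $\mathbf X\in\mathbb R^{n\times d_x}$, $\mathbf Y\in\mathbb R^{n\times d_y}$, $\lambda_x,\lambda_y\ge 0$, and put $\Sigma_{xx}=\mathbf X^{\mathsf T}\mathbf X+\lambda_x\mathbf I$, $\Sigma_{yy}=\mathbf Y^{\mathsf T}\mathbf Y+\lambda_y\mathbf I$, $\Sigma_{xy}=\mathbf X^{\mathsf T}\mathbf Y$; assume that $\Sigma_{xx}$ and $\Sigma_{yy}$ are positive definite. Let $1\le m<\min\{d_x,d_y\}$, $\mu_1>\mu_2>\cdots>\mu_m>0$, $\mathbf N=\mathrm{diag}(\mu_1,\dots,\mu_m)$ and $\delta>0$. Consider the canonical correlation analysis cost function $$f(\mathbf U,\mathbf V)=-\mathrm{tr}(\mathbf U^{\mathsf T}\Sigma_{xy}\mathbf V\mathbf N)$$ on the product of generalized Stiefel manifolds $$\mathcal M=\{\mathbf U\in\mathbb R^{d_x\times m}:\mathbf U^{\mathsf T}\Sigma_{xx}\mathbf U=\mathbf I_m\}\times\{\mathbf V\in\mathbb R^{d_y\times m}:\mathbf V^{\mathsf T}\Sigma_{yy}\mathbf V=\mathbf I_m\},$$ endowed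 with the Riemannian metric $$g_{\mathrm{new},(\mathbf U,\mathbf V)}(\xi,\eta)=\langle\xi_1,\Sigma_{xx}\eta_1\mathbf M_{1,2}\rangle+\langle\xi_2,\Sigma_{yy}\eta_2\mathbf M_{2,2}\rangle,$$ where $\langle A,B\rangle=\mathrm{tr}(A^{\mathsf T}B)$, $\mathrm{sym}(A)=(A+A^{\mathsf T})/2$, $\mathbf M_{1,2}=(\mathrm{sym}(\mathbf U^{\mathsf T}\Sigma_{xy}\mathbf V\mathbf N)^2+\delta\mathbf I_m)^{1/2}$ and $\mathbf M_{2,2}=(\mathrm{sym}(\mathbf V^{\mathsf T}\Sigma_{xy}^{\mathsf T}\mathbf U\mathbf N)^2+\delta\mathbf I_m)^{1/2}$. Let $\sigma_1\ge\sigma_2\ge\cdots\ge\sigma_{\min\{d_x,d_y\}}\ge 0$ be the singular values of $\Sigma_{xx}^{-1/2}\Sigma_{xy}\Sigma_{yy}^{-1/2}$, and assume that $\sigma_1>\sigma_2>\cdots>\sigma_m>\sigma_{m+1}$. Let $(\mathbf U^*,\mathbf V^*)=(\Sigma_{xx}^{-1/2}\bar{\mathbf U},\Sigma_{yy}^{-1/2}\bar{\mathbf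 V})$, where the columns of $\bar{\mathbf U}$ and $\bar{\mathbf V}$ are the $m$ leading left and right (paired, orthonormal) singular vectors of $\Sigma_{xx}^{-1/2}\Sigma_{xy}\Sigma_{yy}^{-1/2}$. Let $\mathrm{Hess}_{\mathrm{new}}f(\mathbf U^*,\mathbf V^*)[\eta]=\nabla_\eta\,\mathrm{grad}_{\mathrm{new}}f$ be the Riemannian Hessian of $f|_{\mathcal M}$ at $(\mathbf U^*,\mathbf V^*)$, where $\nabla$ is the Levi-Civita connection of $(\mathcal M,g_{\mathrm{new}})$. It is a well-defined operator on the tangent space, and its condition number $\kappa_{\mathrm{new}}$, the ratio $\lambda_{\max}/\lambda_{\min}$ of its largest to its smallest eigenvalue and equally the ratio of the supremum to the infimum of its Rayleigh quotient over nonzero tangent vectors, is $$\kappa_{\mathrm{new}}(\mathrm{Hess}_{\mathrm{new}}f(\mathbf U^*,\mathbf V^*))=\frac{\max\Big\{\max\limits_{i,j\in[m],\,i\ne j}\dfrac{(\mu_i+\mu_j)(\sigma_i+\sigma_j)}{\sqrt{\mu_i^2\sigma_i^2+\delta}+\sqrt{\mu_j^2\sigma_j^2+\delta}},\ \max\limits_{i\in[m]}\dfrac{\mu_i(\sigma_i+\sigma_{m+1})}{\sqrt{\mu_i^2\sigma_i^2+\delta}}\Big\}}{\min\Big\{\min\limits_{i,j\in[m],\,i\ne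 j}\dfrac{(\mu_i-\mu_j)(\sigma_i-\sigma_j)}{\sqrt{\mu_i^2\sigma_i^2+\delta}+\sqrt{\mu_j^2\sigma_j^2+\delta}},\ \min\limits_{i\in[m]}\dfrac{\mu_i(\sigma_i-\sigma_{m+1})}{\sqrt{\mu_i^2\sigma_i^2+\delta}}\Big\}},$$ where $[m]=\{1,\dots,m\}$ and, for $m=1$, the terms over $i\ne j$ are absent. -/

import Mathlib

open scoped ContDiff Matrix

noncomputable section

/-! ### Riemannian submanifolds of a normed space

`M` is a submanifold of `E` and `g y` is, for `y ∈ M`, an inner product on the tangent space of `M`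
at `y`, depending smoothly on `y` (and given by a formula on all of `E`). -/

namespace EmbeddedRiem

variable {E : Type*} [NormedAddCommGroup E] [NormedSpace ℝ E]

/-- The tangent space of `M` at `x`: the velocities at `x` of the smooth curves in `M`. -/
def tangentSpace (M : Set E) (x : E) : Set E :=
  {ξ | ∃ c : ℝ → E, ContDiff ℝ ∞ c ∧ (∀ t, c t ∈ M) ∧ c 0 = x ∧ deriv c 0 = ξ}

/-- `X` restricts to a smooth vector field on `M`: it is smooth on an open set that contains `M`,
and tangent to `M` at the points of `M`. -/
def IsTangentField (M : Set E) (X : E → E) : Prop :=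
  (∃ O : Set E, IsOpen O ∧ M ⊆ O ∧ ContDiffOn ℝ ∞ X O) ∧ ∀ y ∈ M, X y ∈ tangentSpace M y

/-- The right-hand side of the Koszul formula for `2 g(∇_X Y, Z)` at the point `x`:
`X g(Y, Z) + Y g(X, Z) - Z g(X, Y) + g([X, Y], Z) - g([X, Z], Y) - g([Y, Z], X)`. For tangent
fields, at a point of `M`, each term depends only on the restrictions to `M`. -/
def koszul (g : E → LinearMap.BilinForm ℝ E) (X Y Z : E → E) (x : E) : ℝ :=
  fderiv ℝ (fun y => g y (Y y) (Z y)) x (X x)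
    + fderiv ℝ (fun y => g y (X y) (Z y)) x (Y x)
    - fderiv ℝ (fun y => g y (X y) (Y y)) x (Z x)
    + g x (VectorField.lieBracket ℝ X Y x) (Z x)
    - g x (VectorField.lieBracket ℝ X Z x) (Y x)
    - g x (VectorField.lieBracket ℝ Y Z x) (X x)

/-- The Koszul formula makes the connection compatible with the metric. -/
theorem koszul_metric (g : E → LinearMap.BilinForm ℝ E) (hg : ∀ x ξ η, g x ξ η = g x η ξ)
    (X Y Z : E → E) (x : E) :
    koszul g X Y Z x + koszul g X Z Y x = 2 * fderiv ℝ (fun y => g y (Y y) (Z y)) x (X x) := by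
  have h1 : (fun y => g y (Z y) (Y y)) = fun y => g y (Y y) (Z y) := funext fun y => hg _ _ _
  have h2 : VectorField.lieBracket ℝ Z Y x = -VectorField.lieBracket ℝ Y Z x := by
    simp [VectorField.lieBracket]
  simp only [koszul, h1, h2, map_neg, LinearMap.neg_apply]
  ring

/-- The Koszul formula makes the connection torsion-free. -/
theorem koszul_torsion (g : E → LinearMap.BilinForm ℝ E) (hg : ∀ x ξ η, g x ξ η = g x η ξ)
    (X Y Z : E → E) (x : E) :
    koszul g X Y Z x - koszul g Y X Z x = 2 * g x (VectorField.lieBracket ℝ X Y x) (Z x) := by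
  have h1 : (fun y => g y (Y y) (X y)) = fun y => g y (X y) (Y y) := funext fun y => hg _ _ _
  have h2 : VectorField.lieBracket ℝ Y X x = -VectorField.lieBracket ℝ X Y x := by
    simp [VectorField.lieBracket]
  simp only [koszul, h1, h2, map_neg, LinearMap.neg_apply]
  ring

/-- `w = ∇_η Y` at `x`, for the Levi-Civita connection `∇` of `(M, g)`: the tangent vector at `x`
given by the Koszul formula, in which `X` is any tangent field with `X x = η`. -/
def IsLeviCivitaDeriv (M : Set E) (g : E → LinearMap.BilinForm ℝ E) (x η : E) (Y : E → E)
    (w : E) : Prop :=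
  w ∈ tangentSpace M x ∧ ∀ X Z : E → E, IsTangentField M X → IsTangentField M Z → X x = η →
    2 * g x w (Z x) = koszul g X Y Z x

/-- `v` is the Riemannian gradient at `x` of the restriction of `f` to `M`. -/
def IsRiemGrad (M : Set E) (g : E → LinearMap.BilinForm ℝ E) (f : E → ℝ) (x v : E) : Prop :=
  v ∈ tangentSpace M x ∧ ∀ η ∈ tangentSpace M x, g x v η = fderiv ℝ f x η

/-- `w = Hess f(x)[η] = ∇_η grad f`; here `G` is a smooth extension of the vector field `grad f`. -/
def IsRiemHess (M : Set E) (g : E → LinearMap.BilinForm ℝ E) (f : E → ℝ) (x η w : E) : Prop :=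
  ∃ G : E → E, IsTangentField M G ∧ (∀ y ∈ M, IsRiemGrad M g f y (G y)) ∧
    IsLeviCivitaDeriv M g x η G w

/-- The Riemannian Hessian operator of `f` at `x`, on tangent vectors. -/
def riemHess (M : Set E) (g : E → LinearMap.BilinForm ℝ E) (f : E → ℝ) (x η : E) : E :=
  Classical.epsilon (IsRiemHess M g f x η)

/-- The eigenvalues of the Riemannian Hessian of `f` at `x`. -/
def hessEigenvalues (M : Set E) (g : E → LinearMap.BilinForm ℝ E) (f : E → ℝ) (x : E) : Set ℝ :=
  {r | ∃ η ∈ tangentSpace M x, η ≠ 0 ∧ riemHess M g f x η = r • η}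

/-- The values of the Rayleigh quotient of the Riemannian Hessian of `f` at `x`. -/
def rayleighValues (M : Set E) (g : E → LinearMap.BilinForm ℝ E) (f : E → ℝ) (x : E) : Set ℝ :=
  {r | ∃ η ∈ tangentSpace M x, η ≠ 0 ∧ r = g x η (riemHess M g f x η) / g x η η}

/-- The condition number of the Riemannian Hessian of `f` at `x`: the ratio of its largest to its
smallest eigenvalue. -/
def condNumber (M : Set E) (g : E → LinearMap.BilinForm ℝ E) (f : E → ℝ) (x : E) : ℝ :=
  sSup (hessEigenvalues M g f x) / sInf (hessEigenvalues M g f x)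

end EmbeddedRiem

/-! ### Canonical correlation analysis -/

namespace CCA

section Sqrt

open scoped MatrixOrder

/-- The positive semidefinite square root of a positive semidefinite real matrix. -/
def msqrt {k : ℕ} (A : Matrix (Fin k) (Fin k) ℝ) : Matrix (Fin k) (Fin k) ℝ := CFC.sqrt A

end Sqrt

/-- `XᵀX + λ I`. -/
def regGram {n d : ℕ} (X : Matrix (Fin n) (Fin d) ℝ) (lam : ℝ) : Matrix (Fin d) (Fin d) ℝ :=
  Xᵀ * X + lam • (1 : Matrix (Fin d) (Fin d) ℝ)

/-- The symmetric part of a square matrix. -/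
def symPart {k : ℕ} (A : Matrix (Fin k) (Fin k) ℝ) : Matrix (Fin k) (Fin k) ℝ :=
  (1 / 2 : ℝ) • (A + Aᵀ)

/-- The generalized Stiefel manifold `{U : Uᵀ S U = I}`. -/
def genStiefel {d : ℕ} (m : ℕ) (S : Matrix (Fin d) (Fin d) ℝ) : Set (Matrix (Fin d) (Fin m) ℝ) :=
  {U | Uᵀ * S * U = 1}

/-- The cost function `f(U, V) = -tr(Uᵀ Sxy V N)` with `N = diag(μ)`. -/
def cost {dx dy m : ℕ} (Sxy : Matrix (Fin dx) (Fin dy) ℝ) (mu : Fin m → ℝ)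
    (p : Matrix (Fin dx) (Fin m) ℝ × Matrix (Fin dy) (Fin m) ℝ) : ℝ :=
  -(p.1ᵀ * Sxy * p.2 * Matrix.diagonal mu).trace

/-- The right preconditioner `(sym(Uᵀ Sxy V N)² + δ I)^{1/2}`. -/
def rightPrec {dx dy m : ℕ} (Sxy : Matrix (Fin dx) (Fin dy) ℝ) (mu : Fin m → ℝ) (delta : ℝ)
    (U : Matrix (Fin dx) (Fin m) ℝ) (V : Matrix (Fin dy) (Fin m) ℝ) : Matrix (Fin m) (Fin m) ℝ :=
  msqrt (symPart (Uᵀ * Sxy * V * Matrix.diagonal mu) ^ 2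
    + delta • (1 : Matrix (Fin m) (Fin m) ℝ))

/-- The preconditioned metric
`⟨ξ₁, Sxx η₁ M₁₂⟩ + ⟨ξ₂, Syy η₂ M₂₂⟩` at `p = (U, V)`, where `⟨A, B⟩ = tr(Aᵀ B)`,
`M₁₂ = (sym(Uᵀ Sxy V N)² + δ I)^{1/2}` and `M₂₂ = (sym(Vᵀ Sxyᵀ U N)² + δ I)^{1/2}`. -/
def newMetric {dx dy m : ℕ} (Sxx : Matrix (Fin dx) (Fin dx) ℝ) (Syy : Matrix (Fin dy) (Fin dy) ℝ)
    (Sxy : Matrix (Fin dx) (Fin dy) ℝ) (mu : Fin m → ℝ) (delta : ℝ)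
    (p : Matrix (Fin dx) (Fin m) ℝ × Matrix (Fin dy) (Fin m) ℝ) :
    LinearMap.BilinForm ℝ (Matrix (Fin dx) (Fin m) ℝ × Matrix (Fin dy) (Fin m) ℝ) :=
  LinearMap.mk₂ ℝ
    (fun ξ η =>
      (ξ.1ᵀ * (Sxx * η.1 * rightPrec Sxy mu delta p.1 p.2)).trace
        + (ξ.2ᵀ * (Syy * η.2 * rightPrec Sxyᵀ mu delta p.2 p.1)).trace)
    (by intro a b c; simp [Matrix.add_mul]; ring)
    (by intro r a b; simp; ring)
    (by intro a b c; simp [Matrix.add_mul, Matrix.mul_add]; ring)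
    (by intro r a b; simp; ring)

/-- The whitened cross-covariance matrix `Sxx^{-1/2} Sxy Syy^{-1/2}`. -/
def whitened {dx dy : ℕ} (Sxx : Matrix (Fin dx) (Fin dx) ℝ) (Syy : Matrix (Fin dy) (Fin dy) ℝ)
    (Sxy : Matrix (Fin dx) (Fin dy) ℝ) : Matrix (Fin dx) (Fin dy) ℝ :=
  (msqrt Sxx)⁻¹ * Sxy * (msqrt Syy)⁻¹

/-- The singular values of a real matrix in nonincreasing order, counted from `0`. -/
def sval {dx dy : ℕ} (A : Matrix (Fin dx) (Fin dy) ℝ) (k : ℕ) : ℝ :=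
  (Matrix.toEuclideanLin A).singularValues k

/-- The columns of `P` and `Q` are `m` leading left and right singular vectors of `A`. -/
def IsLeadingSingularVectors {dx dy m : ℕ} (A : Matrix (Fin dx) (Fin dy) ℝ)
    (P : Matrix (Fin dx) (Fin m) ℝ) (Q : Matrix (Fin dy) (Fin m) ℝ) : Prop :=
  Pᵀ * P = 1 ∧ Qᵀ * Q = 1 ∧
    A * Q = P * Matrix.diagonal (fun i : Fin m => sval A i) ∧
    Aᵀ * P = Q * Matrix.diagonal (fun i : Fin m => sval A i)

end CCA

end

attribute [local instance] Matrix.normedAddCommGroup Matrix.normedSpace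

/-! Since (U*, V*) is critical, the gradient field vanishes there and every term of the Koszul
formula that differentiates the metric drops out. The Hessian is then the ordinary derivative of any
smooth extension of the gradient, and its form on tangent vectors is `D²f(η, ζ) + Df(D(Pζ)[η])` for
any smooth family `P` of tangent projections (`hessian_at_critical`). So the metric enters only
through its value at the point, where both preconditioners are diagonal with entries s_i =
√(μ_i²σ_i² + δ).

Put a = Sxx^{1/2} η₁ and b = Syy^{1/2} η₂, and let P, Q hold the leading singular vectors of the
whitened matrix A. Metric and Hessian become `metricForm` and `hessForm`, and tangency says that Pᵀa
and Qᵀb are skew-symmetric. With x = (Pᵀa_j)_i and y = (Qᵀb_j)_i, the entries (i,j) and (j,i)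
together contribute (s_i + s_j)(x² + y²) to the metric and (μ_iσ_i + μ_jσ_j)(x² + y²) - 2(μ_iσ_j +
μ_jσ_i)xy to the Hessian. The extreme ratios, at y = -e x with e = ±1, are (μ_i + eμ_j)(σ_i +
eσ_j)/(s_i + s_j). The components orthogonal to the leading vectors decouple. The strict gaps
determine those vectors up to sign, so A is bounded by σ_{m+1} on the complement, and the extreme
ratios there are μ_i(σ_i + eσ_{m+1})/s_i, reached at the next singular pair.

`form_nonneg` turns this into bounds on all tangent vectors; `exists_rotation` and `exists_exchange`
show that each candidate is an eigenvalue. Hence the largest candidate with e = 1 and the smallest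
with e = -1 are the extreme eigenvalues. -/

namespace EmbeddedRiem

/-! ### The Riemannian Hessian at a critical point -/

variable {E : Type*} [NormedAddCommGroup E] [NormedSpace ℝ E]

/-- Functions that agree on `M` have the same derivative along tangent vectors of `M`. -/
theorem fderiv_eq_of_eqOn {F : Type*} [NormedAddCommGroup F] [NormedSpace ℝ F] {M : Set E} {x η : E}
    (hη : η ∈ tangentSpace M x) {a b : E → F} (hab : ∀ y ∈ M, a y = b y)
    (ha : DifferentiableAt ℝ a x) (hb : DifferentiableAt ℝ b x) :
    fderiv ℝ a x η = fderiv ℝ b x η := by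
  obtain ⟨c, hc, hcM, rfl, rfl⟩ := hη
  have hd : HasDerivAt c (deriv c 0) 0 := (hc.differentiable (by simp) 0).hasDerivAt
  have h1 := ha.hasFDerivAt.comp_hasDerivAt (0 : ℝ) hd
  have h2 := hb.hasFDerivAt.comp_hasDerivAt (0 : ℝ) hd
  have h3 : a ∘ c = b ∘ c := funext fun t => hab _ (hcM t)
  rw [h3] at h1
  exact h1.unique h2

theorem IsTangentField.differentiableAt {M : Set E} {X : E → E} (hX : IsTangentField M X) {x : E}
    (hx : x ∈ M) : DifferentiableAt ℝ X x := by
  obtain ⟨⟨O, hO, hMO, hXO⟩, -⟩ := hX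
  exact (hXO.contDiffAt (hO.mem_nhds (hMO hx))).differentiableAt (by simp)

/-- A smooth family of projections of the ambient space onto the tangent spaces of `M`. -/
structure IsTangentProj (M : Set E) (P : E → E →L[ℝ] E) : Prop where
  contDiff : ContDiff ℝ ∞ P
  mem : ∀ y ∈ M, ∀ v, P y v ∈ tangentSpace M y
  apply_eq : ∀ y ∈ M, ∀ v ∈ tangentSpace M y, P y v = v

namespace IsTangentProj

variable {M : Set E} {P : E → E →L[ℝ] E}

theorem contDiff_apply (hP : IsTangentProj M P) (v : E) : ContDiff ℝ ∞ fun y => P y v :=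
  hP.contDiff.clm_apply contDiff_const

theorem isTangentField (hP : IsTangentProj M P) (v : E) : IsTangentField M fun y => P y v :=
  ⟨⟨Set.univ, isOpen_univ, Set.subset_univ _, (hP.contDiff_apply v).contDiffOn⟩,
    fun y hy => hP.mem y hy v⟩

theorem mem_iff (hP : IsTangentProj M P) {y : E} (hy : y ∈ M) (v : E) :
    v ∈ tangentSpace M y ↔ P y v = v :=
  ⟨hP.apply_eq y hy v, fun h => h ▸ hP.mem y hy v⟩

theorem sub_mem (hP : IsTangentProj M P) {y : E} (hy : y ∈ M) {v w : E}
    (hv : v ∈ tangentSpace M y) (hw : w ∈ tangentSpace M y) : v - w ∈ tangentSpace M y := by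
  rw [hP.mem_iff hy] at *
  rw [map_sub, hv, hw]

theorem smul_mem (hP : IsTangentProj M P) {y : E} (hy : y ∈ M) {v : E}
    (hv : v ∈ tangentSpace M y) (r : ℝ) : r • v ∈ tangentSpace M y := by
  rw [hP.mem_iff hy] at *
  rw [map_smul, hv]

end IsTangentProj

variable [FiniteDimensional ℝ E]

/-- A bilinear form on a finite-dimensional space, as a continuous bilinear map. -/
noncomputable def toCLM₂ (b : LinearMap.BilinForm ℝ E) : E →L[ℝ] E →L[ℝ] ℝ :=
  LinearMap.toContinuousLinearMap
    ((LinearMap.toContinuousLinearMap : (E →ₗ[ℝ] ℝ) ≃ₗ[ℝ] (E →L[ℝ] ℝ)).toLinearMap ∘ₗ b)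

@[simp] theorem toCLM₂_apply (b : LinearMap.BilinForm ℝ E) (u v : E) : toCLM₂ b u v = b u v := rfl

theorem contDiff_toCLM₂ {g : E → LinearMap.BilinForm ℝ E}
    (hg : ∀ u v, ContDiff ℝ ∞ fun y => g y u v) : ContDiff ℝ ∞ fun y => toCLM₂ (g y) :=
  contDiff_clm_apply_iff.2 fun u => contDiff_clm_apply_iff.2 fun v => hg u v

/-- The derivative of `g(Y, Z)` by the product rule. -/
theorem fderiv_metric {g : E → LinearMap.BilinForm ℝ E}
    (hg : ∀ u v, ContDiff ℝ ∞ fun y => g y u v) {Y Z : E → E} {x : E}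
    (hY : DifferentiableAt ℝ Y x) (hZ : DifferentiableAt ℝ Z x) (v : E) :
    fderiv ℝ (fun y => g y (Y y) (Z y)) x v =
      fderiv ℝ (fun y => toCLM₂ (g y)) x v (Y x) (Z x) + g x (fderiv ℝ Y x v) (Z x)
        + g x (Y x) (fderiv ℝ Z x v) := by
  have h0 : HasFDerivAt (fun y => toCLM₂ (g y)) _ x :=
    ((contDiff_toCLM₂ hg).differentiable (by simp) x).hasFDerivAt
  have h1 := (h0.clm_apply hY.hasFDerivAt).clm_apply hZ.hasFDerivAt
  have h2 : (fun y => g y (Y y) (Z y)) = fun y => toCLM₂ (g y) (Y y) (Z y) := rfl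
  rw [h2, h1.fderiv]
  simp
  ring

/-- The Koszul expression in an ambient vector space: every derivative of `X` and `Z` cancels. -/
theorem koszul_eq {g : E → LinearMap.BilinForm ℝ E} (hg : ∀ u v, ContDiff ℝ ∞ fun y => g y u v)
    (hsymm : ∀ y u v, g y u v = g y v u) {X Y Z : E → E} {x : E} (hX : DifferentiableAt ℝ X x)
    (hY : DifferentiableAt ℝ Y x) (hZ : DifferentiableAt ℝ Z x) :
    koszul g X Y Z x =
      fderiv ℝ (fun y => toCLM₂ (g y)) x (X x) (Y x) (Z x)
        + fderiv ℝ (fun y => toCLM₂ (g y)) x (Y x) (X x) (Z x)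
        - fderiv ℝ (fun y => toCLM₂ (g y)) x (Z x) (X x) (Y x)
        + 2 * g x (fderiv ℝ Y x (X x)) (Z x) := by
  rw [koszul, fderiv_metric hg hY hZ, fderiv_metric hg hX hZ, fderiv_metric hg hX hY]
  simp only [VectorField.lieBracket, map_sub, LinearMap.sub_apply]
  rw [hsymm x (Y x) (fderiv ℝ Z x (X x)), hsymm x (X x) (fderiv ℝ Z x (Y x)),
    hsymm x (X x) (fderiv ℝ Y x (Z x))]
  ring

/-- The gradient of `f` along `M` extends to a smooth vector field. -/
theorem exists_gradient {M : Set E} {P : E → E →L[ℝ] E} (hP : IsTangentProj M P)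
    {g : E → LinearMap.BilinForm ℝ E} (hg : ∀ u v, ContDiff ℝ ∞ fun y => g y u v)
    (hpos : ∀ y v, v ≠ 0 → 0 < g y v v) {f : E → ℝ} (hf : ContDiff ℝ ∞ f) :
    ∃ G : E → E, IsTangentField M G ∧ ∀ y ∈ M, IsRiemGrad M g f y (G y) := by
  have hnn : ∀ y v, 0 ≤ g y v v := fun y v => by
    rcases eq_or_ne v 0 with rfl | hv
    · simp
    · exact (hpos y v hv).le
  -- `B y` is an inner product on all of `E`, even off `M` where `P y` need not be idempotent: `P y
  -- v = 0` and `v - P y v = 0` force `v = 0`. On `M` the second summand vanishes against tangent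
  -- vectors, so applying `P y` to the `B y`-representative of `Df ∘ P y` gives the gradient.
  let B : E → LinearMap.BilinForm ℝ E := fun y =>
    (g y).compl₁₂ (P y).toLinearMap (P y).toLinearMap
      + (g y).compl₁₂ (LinearMap.id - (P y).toLinearMap) (LinearMap.id - (P y).toLinearMap)
  have hB : ∀ y u v, B y u v = g y (P y u) (P y v) + g y (u - P y u) (v - P y v) := fun _ _ _ => rfl
  have hBs : ContDiff ℝ ∞ fun y => toCLM₂ (B y) := by
    refine contDiff_toCLM₂ fun u v => ?_
    have h0 := contDiff_toCLM₂ hg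
    have h1 := (h0.clm_apply (hP.contDiff_apply u)).clm_apply (hP.contDiff_apply v)
    have h2 := (h0.clm_apply (contDiff_const.sub (hP.contDiff_apply u) (f := fun _ => u))).clm_apply
      (contDiff_const.sub (hP.contDiff_apply v) (f := fun _ => v))
    exact h1.add h2
  have hinj : ∀ y, Function.Injective (toCLM₂ (B y)) := fun y => by
    rw [injective_iff_map_eq_zero]
    intro v hv
    have h0 : B y v v = 0 := by rw [← toCLM₂_apply, hv]; rfl
    rw [hB] at h0
    have h1 := hnn y (P y v)
    have h2 := hnn y (v - P y v)
    have h3 : P y v = 0 := by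
      by_contra h
      linarith [hpos y _ h]
    by_contra h
    have : v - P y v ≠ 0 := by simpa [h3] using h
    linarith [hpos y _ this]
  have hdim : Module.finrank ℝ E = Module.finrank ℝ (E →L[ℝ] ℝ) := by
    rw [← (LinearMap.toContinuousLinearMap : (E →ₗ[ℝ] ℝ) ≃ₗ[ℝ] (E →L[ℝ] ℝ)).finrank_eq]
    exact (Subspace.dual_finrank_eq (K := ℝ) (V := E)).symm
  let e : E → E ≃L[ℝ] (E →L[ℝ] ℝ) := fun y =>
    (LinearEquiv.ofInjectiveOfFinrankEq (toCLM₂ (B y)).toLinearMap (hinj y) hdim).toContinuousLinearEquiv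
  have he : ∀ y, ((e y : E ≃L[ℝ] (E →L[ℝ] ℝ)) : E →L[ℝ] (E →L[ℝ] ℝ)) = toCLM₂ (B y) := fun y => by
    ext u v; rfl
  have hinv : ContDiff ℝ ∞ fun y => (toCLM₂ (B y)).inverse := by
    rw [contDiff_iff_contDiffAt]
    intro y
    have := contDiffAt_map_inverse (𝕜 := ℝ) (n := ∞) (e y)
    rw [he] at this
    exact this.comp y hBs.contDiffAt
  have hdf : ContDiff ℝ ∞ (fderiv ℝ f) := hf.fderiv_right (by simp)
  refine ⟨fun y => P y ((toCLM₂ (B y)).inverse ((fderiv ℝ f y).comp (P y))),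
    ⟨⟨Set.univ, isOpen_univ, Set.subset_univ _, ?_⟩, fun y hy => hP.mem y hy _⟩, ?_⟩
  · exact (hP.contDiff.clm_apply (hinv.clm_apply (hdf.clm_comp hP.contDiff))).contDiffOn
  · intro y hy
    refine ⟨hP.mem y hy _, fun η hη => ?_⟩
    set v := (toCLM₂ (B y)).inverse ((fderiv ℝ f y).comp (P y)) with hv
    have h1 : toCLM₂ (B y) v = (fderiv ℝ f y).comp (P y) := by
      rw [hv, ← he y, ContinuousLinearMap.inverse_equiv]
      simp
    have h2 := congrArg (fun l => l η) h1
    simp only [toCLM₂_apply, hB, ContinuousLinearMap.comp_apply, hP.apply_eq y hy η hη, sub_self,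
      map_zero, add_zero] at h2
    exact h2

/-- At a critical point the Hessian exists, is unique, and is given by second derivatives of the
function and first derivatives of a tangent projection. -/
theorem hessian_at_critical {M : Set E} {P : E → E →L[ℝ] E} (hP : IsTangentProj M P)
    {g : E → LinearMap.BilinForm ℝ E} (hg : ∀ u v, ContDiff ℝ ∞ fun y => g y u v)
    (hsymm : ∀ y u v, g y u v = g y v u)
    (hpos : ∀ y v, v ≠ 0 → 0 < g y v v) {f : E → ℝ} (hf : ContDiff ℝ ∞ f) {x : E} (hx : x ∈ M)
    (hcrit : ∀ η ∈ tangentSpace M x, fderiv ℝ f x η = 0) {η : E} (hη : η ∈ tangentSpace M x) :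
    (∃! w, IsRiemHess M g f x η w) ∧ riemHess M g f x η ∈ tangentSpace M x ∧
      ∀ ζ ∈ tangentSpace M x, g x (riemHess M g f x η) ζ =
        fderiv ℝ (fun y => fderiv ℝ f y ζ) x η + fderiv ℝ f x (fderiv ℝ (fun y => P y ζ) x η) := by
  have hnondeg : ∀ y ∈ M, ∀ v w, v ∈ tangentSpace M y → w ∈ tangentSpace M y →
      (∀ ζ ∈ tangentSpace M y, g y v ζ = g y w ζ) → v = w := by
    intro y hy v w hv hw h
    by_contra hne
    have := hpos y (v - w) (sub_ne_zero.2 hne)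
    rw [LinearMap.map_sub₂, h _ (hP.sub_mem hy hv hw), sub_self] at this
    exact this.false
  have hzero : ∀ G : E → E, (∀ y ∈ M, IsRiemGrad M g f y (G y)) → G x = 0 := by
    intro G hG
    by_contra h
    have h1 := hpos x _ h
    rw [(hG x hx).2 _ (hG x hx).1, hcrit _ (hG x hx).1] at h1
    exact h1.false
  -- Each metric-derivative term of `koszul_eq` is linear in `G x`, which is zero here.
  have hkos : ∀ G : E → E, IsTangentField M G → (∀ y ∈ M, IsRiemGrad M g f y (G y)) →
      ∀ X Z : E → E, IsTangentField M X → IsTangentField M Z → X x = η →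
        koszul g X G Z x = 2 * g x (fderiv ℝ G x η) (Z x) := by
    intro G hGt hG X Z hX hZ hXη
    rw [koszul_eq hg hsymm (hX.differentiableAt hx) (hGt.differentiableAt hx)
      (hZ.differentiableAt hx), hzero G hG, hXη]
    simp
  -- Differentiate `P y (G y) = G y` along `M`; the term with the derivative of `P` carries the
  -- factor `G x = 0`.
  have hmem : ∀ G : E → E, IsTangentField M G → (∀ y ∈ M, IsRiemGrad M g f y (G y)) →
      fderiv ℝ G x η ∈ tangentSpace M x := by
    intro G hGt hG
    have hd := hGt.differentiableAt hx
    have hPd : HasFDerivAt P _ x := (hP.contDiff.differentiable (by simp) x).hasFDerivAt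
    have h1 := hPd.clm_apply hd.hasFDerivAt
    have h2 := fderiv_eq_of_eqOn hη (fun y hy => hP.apply_eq y hy _ (hGt.2 y hy))
      h1.differentiableAt hd
    rw [h1.fderiv, hzero G hG] at h2
    rw [hP.mem_iff hx]
    simpa using h2
  obtain ⟨G, hGt, hG⟩ := exists_gradient hP hg hpos hf (M := M)
  have hex : IsRiemHess M g f x η (fderiv ℝ G x η) :=
    ⟨G, hGt, hG, hmem G hGt hG, fun X Z hX hZ hXη => (hkos G hGt hG X Z hX hZ hXη).symm⟩
  have huniq : ∀ w, IsRiemHess M g f x η w → w = fderiv ℝ G x η := by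
    rintro w ⟨G', hGt', hG', hw, hw'⟩
    -- Two extensions of the gradient agree on `M` by nondegeneracy of the metric, hence so do their
    -- tangential derivatives.
    have h1 : fderiv ℝ G' x η = fderiv ℝ G x η :=
      fderiv_eq_of_eqOn hη (fun y hy => hnondeg y hy _ _ (hG' y hy).1 (hG y hy).1 fun ζ hζ => by
        rw [(hG' y hy).2 ζ hζ, (hG y hy).2 ζ hζ]) (hGt'.differentiableAt hx)
        (hGt.differentiableAt hx)
    rw [← h1]
    refine hnondeg x hx _ _ hw (hmem G' hGt' hG') fun ζ hζ => ?_
    have h2 := hw' _ _ (hP.isTangentField η) (hP.isTangentField ζ) (hP.apply_eq x hx η hη)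
    rw [hkos G' hGt' hG' _ _ (hP.isTangentField η) (hP.isTangentField ζ) (hP.apply_eq x hx η hη)]
      at h2
    rw [hP.apply_eq x hx ζ hζ] at h2
    linarith
  have heq : riemHess M g f x η = fderiv ℝ G x η :=
    huniq _ (Classical.epsilon_spec (p := IsRiemHess M g f x η) ⟨_, hex⟩)
  refine ⟨⟨_, hex, huniq⟩, heq ▸ hmem G hGt hG, fun ζ hζ => ?_⟩
  have hdf : ContDiff ℝ ∞ (fderiv ℝ f) := hf.fderiv_right (by simp)
  have hdf' : HasFDerivAt (fderiv ℝ f) _ x := (hdf.differentiable (by simp) x).hasFDerivAt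
  have hPζ : DifferentiableAt ℝ (fun y => P y ζ) x :=
    (hP.contDiff_apply ζ).differentiable (by simp) x
  have hGd := hGt.differentiableAt hx
  have h1 := hdf'.clm_apply hPζ.hasFDerivAt
  have h2 : DifferentiableAt ℝ (fun y => g y (G y) (P y ζ)) x := by
    have h0 := (contDiff_toCLM₂ hg).differentiable (by simp) x
    exact (h0.clm_apply hGd).clm_apply hPζ
  -- The formula comes from differentiating `g(G, Pζ) = Df(Pζ)` along `η`, with `ζ` extended to the
  -- tangent field `Pζ`.
  have h3 := fderiv_eq_of_eqOn hη (fun y hy => (hG y hy).2 _ (hP.mem y hy ζ)) h2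
    h1.differentiableAt
  rw [fderiv_metric hg hGd hPζ, hzero G hG, h1.fderiv, hP.apply_eq x hx ζ hζ] at h3
  have h4 := hdf'.clm_apply (hasFDerivAt_const ζ x)
  rw [heq, h4.fderiv]
  simpa [add_comm] using h3

end EmbeddedRiem

namespace CCA

/-! ### Smoothness of matrix-valued functions -/

section Smooth

variable {F : Type*} [NormedAddCommGroup F] [NormedSpace ℝ F] {a b c : ℕ}

theorem contDiff_matrix {A : F → Matrix (Fin a) (Fin b) ℝ} {n : WithTop ℕ∞} :
    ContDiff ℝ n A ↔ ∀ i j, ContDiff ℝ n fun y => A y i j :=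
  contDiff_pi.trans (forall_congr' fun _ => contDiff_pi)

theorem contDiff_matrix_mul {A : F → Matrix (Fin a) (Fin b) ℝ} {B : F → Matrix (Fin b) (Fin c) ℝ}
    (hA : ContDiff ℝ ∞ A) (hB : ContDiff ℝ ∞ B) : ContDiff ℝ ∞ fun y => A y * B y := by
  rw [contDiff_matrix] at *
  intro i j
  simp only [Matrix.mul_apply]
  exact ContDiff.sum fun k _ => (hA i k).mul (hB k j)

theorem contDiff_matrix_transpose {A : F → Matrix (Fin a) (Fin b) ℝ} (hA : ContDiff ℝ ∞ A) :
    ContDiff ℝ ∞ fun y => (A y)ᵀ := by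
  rw [contDiff_matrix] at *
  exact fun i j => hA j i

theorem contDiff_matrix_trace {A : F → Matrix (Fin a) (Fin a) ℝ} (hA : ContDiff ℝ ∞ A) :
    ContDiff ℝ ∞ fun y => (A y).trace := by
  rw [contDiff_matrix] at hA
  simp only [Matrix.trace, Matrix.diag]
  exact ContDiff.sum fun k _ => hA k k

theorem contDiff_symPart {A : F → Matrix (Fin a) (Fin a) ℝ} (hA : ContDiff ℝ ∞ A) :
    ContDiff ℝ ∞ fun y => symPart (A y) :=
  (hA.add (contDiff_matrix_transpose hA)).const_smul (1 / 2 : ℝ)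

end Smooth

/-! ### Positive definite matrices and their square roots -/

theorem symPart_transpose {k : ℕ} (A : Matrix (Fin k) (Fin k) ℝ) : (symPart A)ᵀ = symPart A := by
  simp [symPart, add_comm]

theorem trace_transpose_mul_self_pos {a b : ℕ} {A : Matrix (Fin a) (Fin b) ℝ} (hA : A ≠ 0) :
    0 < (Aᵀ * A).trace := by
  have h1 := (Matrix.posSemidef_conjTranspose_mul_self A).trace_nonneg
  have h2 := mt Matrix.trace_conjTranspose_mul_self_eq_zero_iff.1 hA
  rw [Matrix.conjTranspose_eq_transpose_of_trivial] at h1 h2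
  exact lt_of_le_of_ne h1 (Ne.symm h2)

section Sqrt

open scoped MatrixOrder

variable {k : ℕ} {A : Matrix (Fin k) (Fin k) ℝ}

theorem msqrt_posSemidef (A : Matrix (Fin k) (Fin k) ℝ) : (msqrt A).PosSemidef :=
  Matrix.nonneg_iff_posSemidef.1 (CFC.sqrt_nonneg A)

theorem msqrt_transpose (A : Matrix (Fin k) (Fin k) ℝ) : (msqrt A)ᵀ = msqrt A := by
  have := (msqrt_posSemidef A).1.eq
  rwa [Matrix.conjTranspose_eq_transpose_of_trivial] at this

theorem msqrt_mul_self (hA : A.PosDef) : msqrt A * msqrt A = A :=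
  CFC.sqrt_mul_sqrt_self A (Matrix.nonneg_iff_posSemidef.2 hA.posSemidef)

theorem msqrt_eq {B : Matrix (Fin k) (Fin k) ℝ} (hB : B.PosSemidef) (h : B * B = A) :
    msqrt A = B :=
  CFC.sqrt_unique h (Matrix.nonneg_iff_posSemidef.2 hB)

theorem msqrt_posDef (hA : A.PosDef) : (msqrt A).PosDef := by
  refine (msqrt_posSemidef A).posDef_iff_isUnit.2 ?_
  have h := hA.isUnit
  rw [← msqrt_mul_self hA] at h
  exact isUnit_of_mul_isUnit_left h

end Sqrt

theorem posDef_transpose {k : ℕ} {A : Matrix (Fin k) (Fin k) ℝ} (hA : A.PosDef) : Aᵀ = A := by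
  have := hA.1.eq
  rwa [Matrix.conjTranspose_eq_transpose_of_trivial] at this

theorem trace_mul_mul_pos {a b : ℕ} {S : Matrix (Fin a) (Fin a) ℝ} {R : Matrix (Fin b) (Fin b) ℝ}
    (hS : S.PosDef) (hR : R.PosDef) {A : Matrix (Fin a) (Fin b) ℝ} (hA : A ≠ 0) :
    0 < (Aᵀ * (S * A * R)).trace := by
  have hU1 := (msqrt_posDef hS).isUnit
  have hU2 := (msqrt_posDef hR).isUnit
  have h1 : (Aᵀ * (S * A * R)).trace
      = ((msqrt S * A * msqrt R)ᵀ * (msqrt S * A * msqrt R)).trace := by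
    simp only [Matrix.transpose_mul, msqrt_transpose]
    conv_lhs => rw [← msqrt_mul_self hS, ← msqrt_mul_self hR]
    rw [Matrix.mul_assoc (msqrt R), Matrix.trace_mul_comm (msqrt R)]
    simp only [Matrix.mul_assoc]
  rw [h1]
  refine trace_transpose_mul_self_pos fun h => hA ?_
  rw [Matrix.isUnit_iff_isUnit_det] at hU1 hU2
  calc A = (msqrt S)⁻¹ * (msqrt S * A * msqrt R * (msqrt R)⁻¹) := by
        rw [Matrix.mul_nonsing_inv_cancel_right _ _ hU2, Matrix.nonsing_inv_mul_cancel_left _ _ hU1]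
    _ = 0 := by rw [h, Matrix.zero_mul, Matrix.mul_zero]

/-- A symmetric matrix near a positive definite one is positive definite. -/
theorem eventually_posDef {k : ℕ} {B : Matrix (Fin k) (Fin k) ℝ} (hB : B.PosDef) :
    ∀ᶠ C in nhds B, Cᵀ = C → C.PosDef := by
  -- Compactness of the unit sphere makes the neighbourhood uniform in `x`; homogeneity then covers
  -- all nonzero vectors.
  have h1 : ∀ᶠ C in nhds B, ∀ x ∈ Metric.sphere (0 : Fin k → ℝ) 1, 0 < x ⬝ᵥ C *ᵥ x := by
    refine (isCompact_sphere _ _).eventually_forall_of_forall_eventually fun x hx => ?_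
    have hc : Continuous fun z : Matrix (Fin k) (Fin k) ℝ × (Fin k → ℝ) => z.2 ⬝ᵥ z.1 *ᵥ z.2 := by
      fun_prop
    refine hc.continuousAt.eventually (lt_mem_nhds ?_)
    have hx0 : x ≠ 0 := by
      rintro rfl
      simp at hx
    simpa using hB.dotProduct_mulVec_pos hx0
  filter_upwards [h1] with C hC hCt
  refine Matrix.PosDef.of_dotProduct_mulVec_pos
    (by rw [Matrix.IsHermitian, Matrix.conjTranspose_eq_transpose_of_trivial, hCt]) fun x hx => ?_
  have hn : ‖x‖ ≠ 0 := norm_ne_zero_iff.2 hx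
  have h2 := hC (‖x‖⁻¹ • x) (by simp [norm_smul, hn])
  rw [Matrix.mulVec_smul, smul_dotProduct, dotProduct_smul, smul_eq_mul, smul_eq_mul] at h2
  have h3 : 0 < ‖x‖⁻¹ := by positivity
  simpa using pos_of_mul_pos_right (pos_of_mul_pos_right h2 h3.le) h3.le

/-- The derivative of a map that is quadratic along a line. -/
theorem fderiv_of_quadratic {E F : Type*} [NormedAddCommGroup E] [NormedSpace ℝ E]
    [NormedAddCommGroup F] [NormedSpace ℝ F] {φ : E → F} {y h : E} {a b c : F}
    (hφ : DifferentiableAt ℝ φ y) (hq : ∀ t : ℝ, φ (y + t • h) = a + t • b + t ^ 2 • c) :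
    fderiv ℝ φ y h = b := by
  have hl : HasDerivAt (fun t : ℝ => y + t • h) h 0 := by
    simpa using ((hasDerivAt_id (0 : ℝ)).smul_const h).const_add y
  have h0 : HasFDerivAt φ (fderiv ℝ φ y) (y + (0 : ℝ) • h) := by simpa using hφ.hasFDerivAt
  have h1 := h0.comp_hasDerivAt (0 : ℝ) hl
  have h2 : HasDerivAt (fun t : ℝ => a + t • b + t ^ 2 • c) b 0 := by
    exact ((((hasDerivAt_id (0 : ℝ)).smul_const b).const_add a).add
      (((hasDerivAt_id (0 : ℝ)).pow 2).smul_const c)).congr_deriv (by simp)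
  have h3 : (φ ∘ fun t : ℝ => y + t • h) = fun t : ℝ => a + t • b + t ^ 2 • c := funext hq
  rw [h3] at h1
  exact h1.unique h2

/-- The square root of a smooth family of positive definite matrices is smooth. -/
theorem contDiff_msqrt {F : Type*} [NormedAddCommGroup F] [NormedSpace ℝ F] {k : ℕ}
    {Q : F → Matrix (Fin k) (Fin k) ℝ} (hQ : ContDiff ℝ ∞ Q) (hpd : ∀ y, (Q y).PosDef) :
    ContDiff ℝ ∞ fun y => msqrt (Q y) := by
  rw [contDiff_iff_contDiffAt]
  intro y
  set B := msqrt (Q y) with hBdef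
  have hB : B.PosDef := msqrt_posDef (hpd y)
  have hBB : B * B = Q y := msqrt_mul_self (hpd y)
  let sq : Matrix (Fin k) (Fin k) ℝ → Matrix (Fin k) (Fin k) ℝ := fun C => C * C
  have hsq : ContDiff ℝ ∞ sq := contDiff_matrix_mul contDiff_id contDiff_id
  have hD : ∀ H, fderiv ℝ sq B H = B * H + H * B := by
    intro H
    refine fderiv_of_quadratic (a := B * B) (c := H * H) (hsq.differentiable (by simp) B) fun t => ?_
    simp only [sq, Matrix.add_mul, Matrix.mul_add, Matrix.smul_mul, Matrix.mul_smul]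
    module
  -- The derivative of squaring is `H ↦ BH + HB`, and tr(Hᵀ(BH + HB)) > 0 for `H ≠ 0`. The inverse
  -- function theorem therefore gives a smooth local square root `φ`, still to be identified with
  -- `msqrt`.
  have hinj : Function.Injective (fderiv ℝ sq B) := by
    rw [injective_iff_map_eq_zero]
    intro H hH
    rw [hD] at hH
    by_contra hne
    have h1 := trace_mul_mul_pos hB Matrix.PosDef.one hne
    have h2 := trace_mul_mul_pos Matrix.PosDef.one hB hne
    have h3 := congrArg (fun C => (Hᵀ * C).trace) hH
    simp [Matrix.mul_add] at h1 h2 h3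
    linarith
  let e : Matrix (Fin k) (Fin k) ℝ ≃L[ℝ] Matrix (Fin k) (Fin k) ℝ :=
    (LinearEquiv.ofInjectiveEndo (fderiv ℝ sq B).toLinearMap hinj).toContinuousLinearEquiv
  have he : HasFDerivAt sq (e : Matrix (Fin k) (Fin k) ℝ →L[ℝ] Matrix (Fin k) (Fin k) ℝ) B := by
    have : (e : Matrix (Fin k) (Fin k) ℝ →L[ℝ] Matrix (Fin k) (Fin k) ℝ) = fderiv ℝ sq B := by
      ext1 H; rfl
    rw [this]
    exact (hsq.differentiable (by simp) B).hasFDerivAt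
  have hst := hsq.contDiffAt.hasStrictFDerivAt' he (by simp)
  have hφs : ContDiffAt ℝ ∞ (hst.localInverse sq e B) (Q y) := by
    rw [← hBB]
    exact hsq.contDiffAt.to_localInverse he (by simp)
  have hφB : hst.localInverse sq e B (Q y) = B := by
    rw [← hBB]
    exact hst.localInverse_apply_image
  have hleft := hst.eventually_left_inverse
  have hright := hst.eventually_right_inverse
  set φ := hst.localInverse sq e B
  have hφQ : ContDiffAt ℝ ∞ (fun z => φ (Q z)) y := hφs.comp y hQ.contDiffAt
  have hcont : Filter.Tendsto (fun z => φ (Q z)) (nhds y) (nhds B) := by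
    have := hφQ.continuousAt.tendsto
    rwa [hφB] at this
  have hcont' : Filter.Tendsto (fun z => (φ (Q z))ᵀ) (nhds y) (nhds B) := by
    have := (continuous_id.matrix_transpose.tendsto B).comp hcont
    rwa [id, posDef_transpose hB] at this
  have hQc : Filter.Tendsto Q (nhds y) (nhds (sq B)) := by
    have := hQ.continuous.tendsto y
    rwa [← hBB] at this
  refine hφQ.congr_of_eventuallyEq ?_
  -- `φ (Q z)` and its transpose are both near `B` and have the same square `Q z`, so local
  -- injectivity makes `φ (Q z)` symmetric. Being near `B` it is then positive definite, and
  -- uniqueness of the positive root applies.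
  filter_upwards [hcont.eventually (eventually_posDef hB), hcont'.eventually hleft,
    hQc.eventually hright] with z hz1 hz2 hz3
  have hz4 : sq (φ (Q z))ᵀ = Q z := by
    simp only [sq] at hz3 ⊢
    rw [← Matrix.transpose_mul, hz3, posDef_transpose (hpd z)]
  rw [hz4] at hz2
  exact msqrt_eq (hz1 hz2.symm).posSemidef hz3

open EmbeddedRiem

/-! ### The product of generalized Stiefel manifolds -/

theorem hasDerivAt_matrix {a b : ℕ} {A : ℝ → Matrix (Fin a) (Fin b) ℝ}
    {A' : Matrix (Fin a) (Fin b) ℝ} {t : ℝ} :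
    HasDerivAt A A' t ↔ ∀ i j, HasDerivAt (fun s => A s i j) (A' i j) t :=
  hasDerivAt_pi.trans (forall_congr' fun _ => hasDerivAt_pi)

theorem hasDerivAt_matrix_mul {a b c : ℕ} {A : ℝ → Matrix (Fin a) (Fin b) ℝ}
    {B : ℝ → Matrix (Fin b) (Fin c) ℝ} {A' : Matrix (Fin a) (Fin b) ℝ}
    {B' : Matrix (Fin b) (Fin c) ℝ} {t : ℝ} (hA : HasDerivAt A A' t) (hB : HasDerivAt B B' t) :
    HasDerivAt (fun s => A s * B s) (A' * B t + A t * B') t := by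
  rw [hasDerivAt_matrix] at *
  intro i j
  simp only [Matrix.mul_apply, Matrix.add_apply, ← Finset.sum_add_distrib]
  exact HasDerivAt.fun_sum fun k _ => (hA i k).mul (hB k j)

theorem hasDerivAt_matrix_transpose {a b : ℕ} {A : ℝ → Matrix (Fin a) (Fin b) ℝ}
    {A' : Matrix (Fin a) (Fin b) ℝ} {t : ℝ} (hA : HasDerivAt A A' t) :
    HasDerivAt (fun s => (A s)ᵀ) A'ᵀ t := by
  rw [hasDerivAt_matrix] at *
  exact fun i j => hA j i

theorem contDiff_matrix_det {F : Type*} [NormedAddCommGroup F] [NormedSpace ℝ F] {k : ℕ}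
    {A : F → Matrix (Fin k) (Fin k) ℝ} (hA : ContDiff ℝ ∞ A) : ContDiff ℝ ∞ fun y => (A y).det := by
  rw [contDiff_matrix] at hA
  simp only [Matrix.det_apply]
  exact ContDiff.sum fun s _ => (contDiff_prod fun i _ => hA _ _).const_smul _

theorem contDiff_matrix_inv {F : Type*} [NormedAddCommGroup F] [NormedSpace ℝ F] {k : ℕ}
    {A : F → Matrix (Fin k) (Fin k) ℝ} (hA : ContDiff ℝ ∞ A) (hpd : ∀ y, (A y).PosDef) :
    ContDiff ℝ ∞ fun y => (A y)⁻¹ := by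
  have hdet : ∀ y, (A y).det ≠ 0 := fun y => (hpd y).det_pos.ne'
  simp only [Matrix.inv_def, Ring.inverse_eq_inv']
  refine ((contDiff_matrix_det hA).inv hdet).smul (contDiff_matrix.2 fun i j => ?_)
  simp only [Matrix.adjugate_apply]
  refine contDiff_matrix_det (contDiff_matrix.2 fun k l => ?_)
  rcases eq_or_ne k j with rfl | h
  · simp only [Matrix.updateRow_self]
    exact contDiff_const
  · simp only [Matrix.updateRow_ne h]
    exact contDiff_matrix.1 hA k l

/-- Every vector that satisfies the linearized constraint is the velocity of a smooth curve in the
generalized Stiefel manifold. -/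
theorem exists_curve_genStiefel {d m : ℕ} {S : Matrix (Fin d) (Fin d) ℝ} (hS : S.PosDef)
    {U ξ : Matrix (Fin d) (Fin m) ℝ} (hU : U ∈ genStiefel m S) (hξ : symPart (Uᵀ * S * ξ) = 0) :
    ∃ c : ℝ → Matrix (Fin d) (Fin m) ℝ, ContDiff ℝ ∞ c ∧ (∀ t, c t ∈ genStiefel m S) ∧ c 0 = U ∧
      HasDerivAt c ξ 0 := by
  have hU' : Uᵀ * S * U = 1 := hU
  set W := ξᵀ * S * ξ with hW
  have hWp : W.PosSemidef := by
    have := hS.posSemidef.conjTranspose_mul_mul_same ξ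
    rwa [Matrix.conjTranspose_eq_transpose_of_trivial] at this
  -- The curve is the polar retraction (U + tξ)(I + t²ξᵀSξ)^{-1/2}: by tangency, `Q t` is exactly
  -- the Gram matrix of `U + tξ`, with no linear term, and it is positive definite for every `t`.
  let Q : ℝ → Matrix (Fin m) (Fin m) ℝ := fun t => 1 + t ^ 2 • W
  have hQ : ∀ t, (Q t).PosDef := fun t =>
    Matrix.PosDef.one.add_posSemidef (hWp.smul (sq_nonneg t))
  have hQs : ContDiff ℝ ∞ Q := contDiff_const.add ((contDiff_id.pow 2).smul contDiff_const)
  let T : ℝ → Matrix (Fin m) (Fin m) ℝ := fun t => (msqrt (Q t))⁻¹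
  have hTs : ContDiff ℝ ∞ T := contDiff_matrix_inv (contDiff_msqrt hQs hQ) fun t => msqrt_posDef (hQ t)
  have hTQ : ∀ t, (T t)ᵀ * Q t * T t = 1 := by
    intro t
    have hu := (Matrix.isUnit_iff_isUnit_det _).1 (msqrt_posDef (hQ t)).isUnit
    have h1 : (T t)ᵀ = T t := by
      simp only [T]
      rw [Matrix.transpose_nonsing_inv, msqrt_transpose]
    rw [h1]
    conv_lhs => rw [← msqrt_mul_self (hQ t)]
    simp only [T]
    rw [Matrix.nonsing_inv_mul_cancel_left _ _ hu, Matrix.mul_nonsing_inv _ hu]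
  have hT0 : T 0 = 1 := by
    have : msqrt (Q 0) = 1 := msqrt_eq Matrix.PosSemidef.one (by simp [Q])
    simp [T, this]
  -- `T` is even in `t`, so its derivative at 0 vanishes without differentiating the square root.
  have hTd : HasDerivAt T 0 0 := by
    have h1 : HasDerivAt T (deriv T 0) 0 := (hTs.differentiable (by simp) 0).hasDerivAt
    have h2 : deriv T 0 = -deriv T 0 := by
      have h3 := deriv_comp_neg T (0 : ℝ)
      have h4 : (fun t => T (-t)) = T := funext fun t => by simp [T, Q]
      rwa [h4, neg_zero] at h3
    have h3 : deriv T 0 = 0 := by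
      ext i j
      have := congrFun (congrFun h2 i) j
      rw [Matrix.neg_apply] at this
      rw [Matrix.zero_apply]
      linarith
    rwa [h3] at h1
  have hC : Uᵀ * S * ξ + ξᵀ * S * U = 0 := by
    have h1 := congrArg (fun A => (2 : ℝ) • A) hξ
    simpa [symPart, posDef_transpose hS, Matrix.mul_assoc, smul_smul] using h1
  refine ⟨fun t => (U + t • ξ) * T t, contDiff_matrix_mul
    (contDiff_const.add (contDiff_id.smul contDiff_const)) hTs, fun t => ?_, by simp [hT0], ?_⟩
  · have h1 : (U + t • ξ)ᵀ * S * (U + t • ξ) = Q t := by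
      have : (U + t • ξ)ᵀ * S * (U + t • ξ)
          = Uᵀ * S * U + t • (Uᵀ * S * ξ + ξᵀ * S * U) + t ^ 2 • (ξᵀ * S * ξ) := by
        simp only [Matrix.transpose_add, Matrix.transpose_smul, Matrix.add_mul, Matrix.mul_add,
          Matrix.smul_mul, Matrix.mul_smul]
        module
      rw [this, hC, hU', smul_zero, add_zero]
    change ((U + t • ξ) * T t)ᵀ * S * ((U + t • ξ) * T t) = 1
    rw [Matrix.transpose_mul, ← hTQ t, ← h1]
    simp only [Matrix.mul_assoc]
  · have h1 : HasDerivAt (fun t : ℝ => U + t • ξ) ξ 0 := by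
      exact (((hasDerivAt_id (0 : ℝ)).smul_const ξ).const_add U).congr_deriv (one_smul ℝ ξ)
    simpa [hT0] using hasDerivAt_matrix_mul h1 hTd

theorem symPart_eq_zero_of_hasDerivAt {d m : ℕ} {S : Matrix (Fin d) (Fin d) ℝ} (hS : S.PosDef)
    {c : ℝ → Matrix (Fin d) (Fin m) ℝ} {ξ : Matrix (Fin d) (Fin m) ℝ}
    (hc : ∀ t, c t ∈ genStiefel m S) (hξ : HasDerivAt c ξ 0) : symPart ((c 0)ᵀ * S * ξ) = 0 := by
  have h1 := hasDerivAt_matrix_mul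
    (hasDerivAt_matrix_mul (hasDerivAt_matrix_transpose hξ) (hasDerivAt_const 0 S)) hξ
  have h2 : (fun t => (c t)ᵀ * S * c t) = fun _ => 1 := funext hc
  rw [h2] at h1
  have h3 := h1.unique (hasDerivAt_const 0 1)
  rw [Matrix.mul_zero, add_zero, add_comm] at h3
  rw [symPart, Matrix.transpose_mul, Matrix.transpose_mul, Matrix.transpose_transpose,
    posDef_transpose hS, ← Matrix.mul_assoc, h3, smul_zero]

variable {dx dy m : ℕ} {Sxx : Matrix (Fin dx) (Fin dx) ℝ} {Syy : Matrix (Fin dy) (Fin dy) ℝ}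

/-- Differentiating the constraint along a curve gives one direction; the polar curves in the two
factors give the other. -/
theorem mem_tangentSpace_iff (hSxx : Sxx.PosDef) (hSyy : Syy.PosDef)
    {p : Matrix (Fin dx) (Fin m) ℝ × Matrix (Fin dy) (Fin m) ℝ}
    (hp : p ∈ genStiefel m Sxx ×ˢ genStiefel m Syy)
    (ξ : Matrix (Fin dx) (Fin m) ℝ × Matrix (Fin dy) (Fin m) ℝ) :
    ξ ∈ tangentSpace (genStiefel m Sxx ×ˢ genStiefel m Syy) p ↔
      symPart (p.1ᵀ * Sxx * ξ.1) = 0 ∧ symPart (p.2ᵀ * Syy * ξ.2) = 0 := by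
  constructor
  · rintro ⟨c, hc, hcM, rfl, rfl⟩
    have hd : HasDerivAt c (deriv c 0) 0 := (hc.differentiable (by simp) 0).hasDerivAt
    exact ⟨symPart_eq_zero_of_hasDerivAt hSxx (c := fun t => (c t).1) (fun t => (hcM t).1) hd.fst,
      symPart_eq_zero_of_hasDerivAt hSyy (c := fun t => (c t).2) (fun t => (hcM t).2) hd.snd⟩
  · rintro ⟨h1, h2⟩
    obtain ⟨c₁, hc₁, hM₁, h0₁, hd₁⟩ := exists_curve_genStiefel hSxx hp.1 h1
    obtain ⟨c₂, hc₂, hM₂, h0₂, hd₂⟩ := exists_curve_genStiefel hSyy hp.2 h2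
    exact ⟨fun t => (c₁ t, c₂ t), hc₁.prodMk hc₂, fun t => ⟨hM₁ t, hM₂ t⟩, by simp [h0₁, h0₂],
      (hd₁.prodMk hd₂).deriv⟩

theorem symPart_add {k : ℕ} (A B : Matrix (Fin k) (Fin k) ℝ) :
    symPart (A + B) = symPart A + symPart B := by
  simp only [symPart, Matrix.transpose_add]
  module

theorem symPart_smul {k : ℕ} (r : ℝ) (A : Matrix (Fin k) (Fin k) ℝ) :
    symPart (r • A) = r • symPart A := by
  simp only [symPart, Matrix.transpose_smul]
  module

theorem symPart_sub {k : ℕ} (A B : Matrix (Fin k) (Fin k) ℝ) :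
    symPart (A - B) = symPart A - symPart B := by
  simp only [symPart, Matrix.transpose_sub]
  module

theorem symPart_of_transpose_eq {k : ℕ} {A : Matrix (Fin k) (Fin k) ℝ} (hA : Aᵀ = A) :
    symPart A = A := by
  rw [symPart, hA]
  module

/-- The projection `ξ ↦ ξ - U sym(Uᵀ S ξ)` onto the tangent space of the generalized Stiefel
manifold at `U`. -/
noncomputable def stiefelProj {d : ℕ} (S : Matrix (Fin d) (Fin d) ℝ) (U : Matrix (Fin d) (Fin m) ℝ) :
    Matrix (Fin d) (Fin m) ℝ →ₗ[ℝ] Matrix (Fin d) (Fin m) ℝ where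
  toFun ξ := ξ - U * symPart (Uᵀ * S * ξ)
  map_add' ξ η := by
    simp only [Matrix.mul_add, symPart_add]
    abel
  map_smul' r ξ := by
    simp only [Matrix.mul_smul, symPart_smul, RingHom.id_apply, smul_sub]

/-- Since UᵀSU = I, the correction subtracts from UᵀSξ exactly its symmetric part. Orthogonality of
the projection for the preconditioned metric is not needed. -/
theorem symPart_stiefelProj {d : ℕ} {S : Matrix (Fin d) (Fin d) ℝ} {U : Matrix (Fin d) (Fin m) ℝ}
    (hU : U ∈ genStiefel m S) (ξ : Matrix (Fin d) (Fin m) ℝ) :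
    symPart (Uᵀ * S * stiefelProj S U ξ) = 0 := by
  have hU' : Uᵀ * S * U = 1 := hU
  simp only [stiefelProj, LinearMap.coe_mk, AddHom.coe_mk, Matrix.mul_sub, symPart_sub]
  rw [← Matrix.mul_assoc, hU', Matrix.one_mul, symPart_of_transpose_eq (symPart_transpose _),
    sub_self]

/-- The projection onto the tangent spaces of the product manifold. -/
noncomputable def prodProj (Sxx : Matrix (Fin dx) (Fin dx) ℝ) (Syy : Matrix (Fin dy) (Fin dy) ℝ)
    (p : Matrix (Fin dx) (Fin m) ℝ × Matrix (Fin dy) (Fin m) ℝ) :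
    (Matrix (Fin dx) (Fin m) ℝ × Matrix (Fin dy) (Fin m) ℝ) →L[ℝ]
      (Matrix (Fin dx) (Fin m) ℝ × Matrix (Fin dy) (Fin m) ℝ) :=
  LinearMap.toContinuousLinearMap ((stiefelProj Sxx p.1).prodMap (stiefelProj Syy p.2))

theorem prodProj_apply (p ξ : Matrix (Fin dx) (Fin m) ℝ × Matrix (Fin dy) (Fin m) ℝ) :
    prodProj Sxx Syy p ξ =
      (ξ.1 - p.1 * symPart (p.1ᵀ * Sxx * ξ.1), ξ.2 - p.2 * symPart (p.2ᵀ * Syy * ξ.2)) := rfl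

theorem contDiff_stiefelProj {F : Type*} [NormedAddCommGroup F] [NormedSpace ℝ F] {d : ℕ}
    {S : Matrix (Fin d) (Fin d) ℝ} {U : F → Matrix (Fin d) (Fin m) ℝ} (hU : ContDiff ℝ ∞ U)
    (ξ : Matrix (Fin d) (Fin m) ℝ) :
    ContDiff ℝ ∞ fun y => ξ - U y * symPart ((U y)ᵀ * S * ξ) :=
  contDiff_const.sub (contDiff_matrix_mul hU (contDiff_symPart (contDiff_matrix_mul
    (contDiff_matrix_mul (contDiff_matrix_transpose hU) contDiff_const) contDiff_const)))

theorem isTangentProj_prodProj (hSxx : Sxx.PosDef) (hSyy : Syy.PosDef) :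
    IsTangentProj (genStiefel m Sxx ×ˢ genStiefel m Syy) (prodProj Sxx Syy) where
  contDiff := contDiff_clm_apply_iff.2 fun ξ =>
    (contDiff_stiefelProj contDiff_fst ξ.1).prodMk (contDiff_stiefelProj contDiff_snd ξ.2)
  mem p hp ξ := (mem_tangentSpace_iff hSxx hSyy hp _).2
    ⟨symPart_stiefelProj hp.1 ξ.1, symPart_stiefelProj hp.2 ξ.2⟩
  apply_eq p hp ξ hξ := by
    obtain ⟨h1, h2⟩ := (mem_tangentSpace_iff hSxx hSyy hp ξ).1 hξ
    refine (prodProj_apply p ξ).trans ?_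
    rw [h1, h2]
    simp

/-! ### The preconditioned metric -/

theorem posDef_sq_add {k : ℕ} {A : Matrix (Fin k) (Fin k) ℝ} (hA : Aᵀ = A) {delta : ℝ}
    (hdelta : 0 < delta) : (A ^ 2 + delta • (1 : Matrix (Fin k) (Fin k) ℝ)).PosDef := by
  have h1 := Matrix.posSemidef_conjTranspose_mul_self A
  rw [Matrix.conjTranspose_eq_transpose_of_trivial, hA, ← sq] at h1
  exact (Matrix.PosDef.one.smul hdelta).posSemidef_add h1

theorem rightPrec_posDef (Sxy : Matrix (Fin dx) (Fin dy) ℝ) (mu : Fin m → ℝ) {delta : ℝ}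
    (hdelta : 0 < delta) (U : Matrix (Fin dx) (Fin m) ℝ) (V : Matrix (Fin dy) (Fin m) ℝ) :
    (rightPrec Sxy mu delta U V).PosDef :=
  msqrt_posDef (posDef_sq_add (symPart_transpose _) hdelta)

/-- The shift by `δ > 0` keeps the matrix under the root positive definite on the whole ambient
space, so the root is smooth even where the symmetric part is singular. -/
theorem contDiff_rightPrec {F : Type*} [NormedAddCommGroup F] [NormedSpace ℝ F]
    (Sxy : Matrix (Fin dx) (Fin dy) ℝ) (mu : Fin m → ℝ) {delta : ℝ} (hdelta : 0 < delta)
    {U : F → Matrix (Fin dx) (Fin m) ℝ} {V : F → Matrix (Fin dy) (Fin m) ℝ}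
    (hU : ContDiff ℝ ∞ U) (hV : ContDiff ℝ ∞ V) :
    ContDiff ℝ ∞ fun y => rightPrec Sxy mu delta (U y) (V y) := by
  refine contDiff_msqrt (Q := fun y => symPart ((U y)ᵀ * Sxy * V y * Matrix.diagonal mu) ^ 2
    + delta • (1 : Matrix (Fin m) (Fin m) ℝ)) ?_ fun y => posDef_sq_add (symPart_transpose _) hdelta
  have h1 : ContDiff ℝ ∞ fun y => symPart ((U y)ᵀ * Sxy * V y * Matrix.diagonal mu) :=
    contDiff_symPart (contDiff_matrix_mul (contDiff_matrix_mul (contDiff_matrix_mul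
      (contDiff_matrix_transpose hU) contDiff_const) hV) contDiff_const)
  simp only [sq]
  exact (contDiff_matrix_mul h1 h1).add contDiff_const

theorem newMetric_apply (Sxx : Matrix (Fin dx) (Fin dx) ℝ) (Syy : Matrix (Fin dy) (Fin dy) ℝ)
    (Sxy : Matrix (Fin dx) (Fin dy) ℝ) (mu : Fin m → ℝ) (delta : ℝ)
    (p ξ η : Matrix (Fin dx) (Fin m) ℝ × Matrix (Fin dy) (Fin m) ℝ) :
    newMetric Sxx Syy Sxy mu delta p ξ η =
      (ξ.1ᵀ * (Sxx * η.1 * rightPrec Sxy mu delta p.1 p.2)).trace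
        + (ξ.2ᵀ * (Syy * η.2 * rightPrec Sxyᵀ mu delta p.2 p.1)).trace := rfl

theorem contDiff_newMetric (Sxy : Matrix (Fin dx) (Fin dy) ℝ) (mu : Fin m → ℝ) {delta : ℝ}
    (hdelta : 0 < delta) (ξ η : Matrix (Fin dx) (Fin m) ℝ × Matrix (Fin dy) (Fin m) ℝ) :
    ContDiff ℝ ∞ fun p => newMetric Sxx Syy Sxy mu delta p ξ η := by
  simp only [newMetric_apply]
  exact (contDiff_matrix_trace (contDiff_matrix_mul contDiff_const (contDiff_matrix_mul
    contDiff_const (contDiff_rightPrec Sxy mu hdelta contDiff_fst contDiff_snd)))).add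
    (contDiff_matrix_trace (contDiff_matrix_mul contDiff_const (contDiff_matrix_mul
    contDiff_const (contDiff_rightPrec Sxyᵀ mu hdelta contDiff_snd contDiff_fst))))

theorem trace_mul_mul_comm {a b : ℕ} {S : Matrix (Fin a) (Fin a) ℝ} {R : Matrix (Fin b) (Fin b) ℝ}
    (hS : Sᵀ = S) (hR : Rᵀ = R) (A B : Matrix (Fin a) (Fin b) ℝ) :
    (Aᵀ * (S * B * R)).trace = (Bᵀ * (S * A * R)).trace := by
  rw [← Matrix.trace_transpose]
  simp only [Matrix.transpose_mul, Matrix.transpose_transpose, hS, hR]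
  rw [Matrix.mul_assoc, Matrix.trace_mul_comm]
  simp only [Matrix.mul_assoc]

theorem newMetric_symm (hSxx : Sxx.PosDef) (hSyy : Syy.PosDef) (Sxy : Matrix (Fin dx) (Fin dy) ℝ)
    (mu : Fin m → ℝ) {delta : ℝ} (hdelta : 0 < delta)
    (p ξ η : Matrix (Fin dx) (Fin m) ℝ × Matrix (Fin dy) (Fin m) ℝ) :
    newMetric Sxx Syy Sxy mu delta p ξ η = newMetric Sxx Syy Sxy mu delta p η ξ := by
  rw [newMetric_apply, newMetric_apply,
    trace_mul_mul_comm (posDef_transpose hSxx) (posDef_transpose (rightPrec_posDef _ _ hdelta _ _)),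
    trace_mul_mul_comm (posDef_transpose hSyy) (posDef_transpose (rightPrec_posDef _ _ hdelta _ _))]

theorem newMetric_pos (hSxx : Sxx.PosDef) (hSyy : Syy.PosDef) (Sxy : Matrix (Fin dx) (Fin dy) ℝ)
    (mu : Fin m → ℝ) {delta : ℝ} (hdelta : 0 < delta)
    (p ξ : Matrix (Fin dx) (Fin m) ℝ × Matrix (Fin dy) (Fin m) ℝ) (hξ : ξ ≠ 0) :
    0 < newMetric Sxx Syy Sxy mu delta p ξ ξ := by
  have key : ∀ {a b : ℕ} {S : Matrix (Fin a) (Fin a) ℝ} {R : Matrix (Fin b) (Fin b) ℝ},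
      S.PosDef → R.PosDef → ∀ A : Matrix (Fin a) (Fin b) ℝ, 0 ≤ (Aᵀ * (S * A * R)).trace := by
    intro a b S R hS hR A
    rcases eq_or_ne A 0 with rfl | h
    · simp
    · exact (trace_mul_mul_pos hS hR h).le
  rw [newMetric_apply]
  have hR1 := rightPrec_posDef Sxy mu hdelta p.1 p.2
  have hR2 := rightPrec_posDef Sxyᵀ mu hdelta p.2 p.1
  by_cases h1 : ξ.1 = 0
  · have h2 : ξ.2 ≠ 0 := fun h2 => hξ (Prod.ext h1 h2)
    linarith [key hSxx hR1 ξ.1, trace_mul_mul_pos hSyy hR2 h2]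
  · linarith [key hSyy hR2 ξ.2, trace_mul_mul_pos hSxx hR1 h1]

/-! ### Leading singular vectors -/

section SingularValues

variable {dx dy m : ℕ} (A : Matrix (Fin dx) (Fin dy) ℝ)

theorem sval_nonneg (k : ℕ) : 0 ≤ sval A k := LinearMap.singularValues_nonneg _ k

theorem sval_antitone : Antitone (sval A) := LinearMap.singularValues_antitone _

/-- An orthogonal matrix that diagonalizes `AᵀA`, with the squared singular values in order. -/
theorem exists_orthogonal_diagonalization :
    ∃ W : Matrix (Fin dy) (Fin dy) ℝ, Wᵀ * W = 1 ∧ W * Wᵀ = 1 ∧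
      Aᵀ * A * W = W * Matrix.diagonal fun k : Fin dy => sval A k ^ 2 := by
  let T := Matrix.toEuclideanLin A
  have hn : Module.finrank ℝ (EuclideanSpace ℝ (Fin dy)) = dy := by simp
  obtain ⟨b, hb⟩ : ∃ b : OrthonormalBasis (Fin dy) ℝ (EuclideanSpace ℝ (Fin dy)),
      ∀ k, Matrix.toEuclideanLin Aᵀ (Matrix.toEuclideanLin A (b k)) = (sval A k ^ 2) • b k := by
    refine ⟨T.isSymmetric_adjoint_comp_self.eigenvectorBasis hn, fun k => ?_⟩
    have h := T.isSymmetric_adjoint_comp_self.apply_eigenvectorBasis hn k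
    rw [← T.sq_singularValues_fin hn] at h
    rw [← Matrix.conjTranspose_eq_transpose_of_trivial,
      Matrix.toEuclideanLin_conjTranspose_eq_adjoint]
    exact h
  let W : Matrix (Fin dy) (Fin dy) ℝ := Matrix.of fun i k => b k i
  have hW : Wᵀ * W = 1 := by
    ext k l
    have h := orthonormal_iff_ite.1 b.orthonormal k l
    rw [Matrix.mul_apply, Matrix.one_apply, ← h, PiLp.inner_apply]
    exact Finset.sum_congr rfl fun i _ => mul_comm _ _
  refine ⟨W, hW, mul_eq_one_comm.1 hW, ?_⟩
  ext i k
  have h : (Aᵀ *ᵥ (A *ᵥ fun j => W j k)) i = sval A k ^ 2 * W i k :=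
    congrArg (fun v : EuclideanSpace ℝ (Fin dy) => v i) (hb k)
  rw [Matrix.mul_diagonal, mul_comm, ← h, Matrix.mulVec_mulVec]
  rfl

variable {A} {P : Matrix (Fin dx) (Fin m) ℝ} {Q : Matrix (Fin dy) (Fin m) ℝ}

/-- Leading singular values are simple: there is a strict drop after each index below `m`, including
the one to `sval A m`, which is σ_{m+1} because counting starts at 0. -/
theorem sval_sq_ne (hanti : ∀ i < m, sval A (i + 1) < sval A i) {i k : ℕ} (hi : i < m)
    (hki : k ≠ i) : sval A k ^ 2 ≠ sval A i ^ 2 := by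
  have hne : sval A k ≠ sval A i := by
    rcases lt_or_gt_of_ne hki with h | h
    · exact ((sval_antitone A h).trans_lt (hanti k (h.trans hi))).ne'
    · exact ((sval_antitone A h).trans_lt (hanti i hi)).ne
  rwa [Ne, sq_eq_sq₀ (sval_nonneg A k) (sval_nonneg A i)]

theorem IsLeadingSingularVectors.gram_mul (h : IsLeadingSingularVectors A P Q) :
    Aᵀ * A * Q = Q * Matrix.diagonal fun i : Fin m => sval A i ^ 2 := by
  obtain ⟨-, -, h3, h4⟩ := h
  rw [Matrix.mul_assoc, h3, ← Matrix.mul_assoc, h4, Matrix.mul_assoc, Matrix.diagonal_mul_diagonal]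
  simp only [sq]

/-- In an orthonormal eigenbasis of `AᵀA`, the leading right singular vectors are, up to sign, the
leading basis vectors. -/
theorem IsLeadingSingularVectors.apply_eq_zero (h : IsLeadingSingularVectors A P Q)
    (hanti : ∀ i < m, sval A (i + 1) < sval A i) {W : Matrix (Fin dy) (Fin dy) ℝ}
    (hW : Aᵀ * A * W = W * Matrix.diagonal fun k : Fin dy => sval A k ^ 2) {k : Fin dy} {i : Fin m}
    (hki : (k : ℕ) ≠ i) : (Wᵀ * Q) k i = 0 := by
  have h1 := congrArg (fun B => (Wᵀ * B) k i) h.gram_mul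
  have h2 := congrArg (fun B => (Bᵀ * Q) k i) hW
  simp only [Matrix.transpose_mul, Matrix.diagonal_transpose, Matrix.transpose_transpose,
    Matrix.mul_assoc, Matrix.diagonal_mul] at h2
  simp only [← Matrix.mul_assoc, Matrix.mul_diagonal] at h1
  simp only [← Matrix.mul_assoc] at h2
  rw [h2] at h1
  have h3 := sval_sq_ne hanti i.2 hki
  have h4 : (sval A k ^ 2 - sval A i ^ 2) * (Wᵀ * Q) k i = 0 := by linarith
  exact (mul_eq_zero.1 h4).resolve_left (sub_ne_zero.2 h3)

/-- In an ordered eigenbasis of AᵀA, orthogonality to the columns of `Q` kills the first `m`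
coordinates of `b`, and the other eigenvalues are at most `sval A m ^ 2`. -/
theorem IsLeadingSingularVectors.dotProduct_mulVec_le (h : IsLeadingSingularVectors A P Q)
    (hanti : ∀ i < m, sval A (i + 1) < sval A i) (b : Fin dy → ℝ) (hb : Qᵀ *ᵥ b = 0) :
    (A *ᵥ b) ⬝ᵥ (A *ᵥ b) ≤ sval A m ^ 2 * (b ⬝ᵥ b) := by
  obtain ⟨W, hW1, hW2, hW⟩ := exists_orthogonal_diagonalization A
  set z := Wᵀ *ᵥ b with hz
  have hbz : b = W *ᵥ z := by rw [hz, Matrix.mulVec_mulVec, hW2, Matrix.one_mulVec]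
  clear_value z
  -- Column `k` of `Wᵀ * Q` is a unit vector supported at `k`, so its pairing with `z` is a nonzero
  -- multiple of `z k`.
  have hzero : ∀ k : Fin dy, (k : ℕ) < m → z k = 0 := by
    intro k hk
    have h1 : (Wᵀ * Q)ᵀ *ᵥ z = 0 := by
      rw [Matrix.transpose_mul, Matrix.transpose_transpose, ← Matrix.mulVec_mulVec, ← hbz, hb]
    have h2 := congrFun h1 ⟨k, hk⟩
    rw [Matrix.mulVec, dotProduct, Finset.sum_eq_single k] at h2
    · have h3 : ((Wᵀ * Q)ᵀ * (Wᵀ * Q)) ⟨k, hk⟩ ⟨k, hk⟩ = 1 := by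
        rw [Matrix.transpose_mul, Matrix.transpose_transpose, Matrix.mul_assoc,
          ← Matrix.mul_assoc W, hW2, Matrix.one_mul, h.2.1, Matrix.one_apply_eq]
      rw [Matrix.mul_apply, Finset.sum_eq_single k] at h3
      · rcases mul_eq_zero.1 h2 with h4 | h4
        · rw [h4, zero_mul] at h3
          exact absurd h3 zero_ne_one
        · exact h4
      · intro l _ hl
        rw [Matrix.transpose_apply, h.apply_eq_zero hanti hW (by simpa [Fin.ext_iff] using hl),
          zero_mul]
      · simp
    · intro l _ hl
      rw [Matrix.transpose_apply, h.apply_eq_zero hanti hW (by simpa [Fin.ext_iff] using hl),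
        zero_mul]
    · simp
  have h1 : b ⬝ᵥ b = z ⬝ᵥ z := by
    rw [hbz, Matrix.dotProduct_mulVec, Matrix.vecMul_mulVec, hW1, Matrix.vecMul_one]
  have h2 : (A *ᵥ b) ⬝ᵥ (A *ᵥ b) = ∑ k : Fin dy, sval A k ^ 2 * (z k * z k) := by
    rw [Matrix.dotProduct_mulVec, Matrix.vecMul_mulVec, ← Matrix.dotProduct_mulVec, hbz,
      Matrix.mulVec_mulVec, hW, ← Matrix.mulVec_mulVec, Matrix.dotProduct_mulVec,
      Matrix.vecMul_mulVec, hW1, Matrix.vecMul_one, dotProduct]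
    refine Finset.sum_congr rfl fun k _ => ?_
    rw [Matrix.mulVec_diagonal]
    ring
  rw [h1, h2, dotProduct, Finset.mul_sum]
  refine Finset.sum_le_sum fun k _ => ?_
  by_cases hk : (k : ℕ) < m
  · simp [hzero k hk]
  · have := pow_le_pow_left₀ (sval_nonneg A k) (sval_antitone A (not_lt.1 hk)) 2
    exact mul_le_mul_of_nonneg_right this (mul_self_nonneg _)

/-- A singular pair for the first singular value after the leading ones; the left vector may be
zero. -/
theorem IsLeadingSingularVectors.exists_next (h : IsLeadingSingularVectors A P Q)
    (hanti : ∀ i < m, sval A (i + 1) < sval A i) (hm : m < dy) :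
    ∃ (u : Fin dx → ℝ) (v : Fin dy → ℝ), v ≠ 0 ∧ Pᵀ *ᵥ u = 0 ∧ Qᵀ *ᵥ v = 0 ∧
      A *ᵥ v = sval A m • u ∧ Aᵀ *ᵥ u = sval A m • v := by
  obtain ⟨W, hW1, hW2, hW⟩ := exists_orthogonal_diagonalization A
  let v : Fin dy → ℝ := fun i => W i ⟨m, hm⟩
  have hv : Aᵀ *ᵥ (A *ᵥ v) = sval A m ^ 2 • v := by
    ext i
    have := congrFun (congrFun hW i) ⟨m, hm⟩
    rw [Matrix.mul_diagonal, Matrix.mul_apply] at this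
    rw [Matrix.mulVec_mulVec, Matrix.mulVec, dotProduct, this, Pi.smul_apply, smul_eq_mul, mul_comm]
  have hQv : Qᵀ *ᵥ v = 0 := by
    ext i
    have := h.apply_eq_zero hanti hW (k := ⟨m, hm⟩) (i := i) i.2.ne'
    rw [Matrix.mul_apply] at this
    rw [Matrix.mulVec, dotProduct, Pi.zero_apply, ← this]
    exact Finset.sum_congr rfl fun k _ => mul_comm _ _
  -- If `sval A m = 0`, the convention `0⁻¹ = 0` makes the left vector zero, and `A *ᵥ v = 0` by the
  -- bound on the complement, so both relations survive.
  refine ⟨(sval A m)⁻¹ • A *ᵥ v, v, ?_, ?_, hQv, ?_, ?_⟩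
  · intro h0
    have h1 := congrFun (congrFun hW1 ⟨m, hm⟩) ⟨m, hm⟩
    have h2 : ∀ i, W i ⟨m, hm⟩ = 0 := fun i => congrFun h0 i
    simp [Matrix.mul_apply, h2] at h1
  · have h1 : Pᵀ * A = Matrix.diagonal (fun i : Fin m => sval A i) * Qᵀ := by
      have := congrArg Matrix.transpose h.2.2.2
      simpa [Matrix.transpose_mul] using this
    rw [Matrix.mulVec_smul, Matrix.mulVec_mulVec, h1, ← Matrix.mulVec_mulVec, hQv,
      Matrix.mulVec_zero, smul_zero]
  · by_cases h0 : sval A m = 0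
    · have h1 := h.dotProduct_mulVec_le hanti v hQv
      rw [h0] at h1 ⊢
      have h2 : (A *ᵥ v) ⬝ᵥ (A *ᵥ v) = 0 :=
        le_antisymm (by simpa using h1) (Finset.sum_nonneg fun i _ => mul_self_nonneg _)
      rw [dotProduct_self_eq_zero.1 h2, zero_smul]
    · rw [smul_smul, mul_inv_cancel₀ h0, one_smul]
  · rw [Matrix.mulVec_smul, hv, smul_smul]
    congr 1
    by_cases h0 : sval A m = 0
    · simp [h0]
    · field_simp

end SingularValues

/-! ### The Hessian and the metric in whitened coordinates

A pair of matrices is given by the families of its columns. -/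

section Whitened

variable {dx dy m : ℕ}

/-- The metric in whitened coordinates. -/
def metricForm (s : Fin m → ℝ) (a a' : Fin m → Fin dx → ℝ) (b b' : Fin m → Fin dy → ℝ) : ℝ :=
  ∑ l, s l * (a l ⬝ᵥ a' l + b l ⬝ᵥ b' l)

/-- The Hessian quadratic form of the cost function in whitened coordinates. -/
def hessForm (A : Matrix (Fin dx) (Fin dy) ℝ) (mu sig : Fin m → ℝ) (a a' : Fin m → Fin dx → ℝ)
    (b b' : Fin m → Fin dy → ℝ) : ℝ :=
  ∑ l, (mu l * sig l * (a l ⬝ᵥ a' l + b l ⬝ᵥ b' l)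
    - mu l * (a l ⬝ᵥ A *ᵥ b' l + a' l ⬝ᵥ A *ᵥ b l))

/-- The columns of `Pᵀ a` form a skew-symmetric matrix. -/
def IsSkewAgainst {d : ℕ} (P : Matrix (Fin d) (Fin m) ℝ) (a : Fin m → Fin d → ℝ) : Prop :=
  ∀ i j, (Pᵀ *ᵥ a j) i = -(Pᵀ *ᵥ a i) j

variable {A : Matrix (Fin dx) (Fin dy) ℝ} {P : Matrix (Fin dx) (Fin m) ℝ}
  {Q : Matrix (Fin dy) (Fin m) ℝ}

theorem dotProduct_self_decomp {d : ℕ} {P : Matrix (Fin d) (Fin m) ℝ} (hP : Pᵀ * P = 1)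
    (x : Fin d → ℝ) :
    x ⬝ᵥ x = (Pᵀ *ᵥ x) ⬝ᵥ (Pᵀ *ᵥ x) + (x - P *ᵥ (Pᵀ *ᵥ x)) ⬝ᵥ (x - P *ᵥ (Pᵀ *ᵥ x)) := by
  have h1 : x ⬝ᵥ P *ᵥ (Pᵀ *ᵥ x) = (Pᵀ *ᵥ x) ⬝ᵥ (Pᵀ *ᵥ x) := by
    rw [Matrix.dotProduct_mulVec, ← Matrix.mulVec_transpose]
  have h2 : (P *ᵥ (Pᵀ *ᵥ x)) ⬝ᵥ P *ᵥ (Pᵀ *ᵥ x) = (Pᵀ *ᵥ x) ⬝ᵥ (Pᵀ *ᵥ x) := by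
    rw [Matrix.dotProduct_mulVec, Matrix.vecMul_mulVec, hP, Matrix.vecMul_one]
  rw [sub_dotProduct, dotProduct_sub, dotProduct_sub, h2, dotProduct_comm (P *ᵥ (Pᵀ *ᵥ x)) x, h1]
  ring

/-- Expand |σx ± Ay|² ≥ 0 with σ = `sval A m`, use |Ay|² ≤ σ²|y|², and divide by σ; if σ = 0 then Ay
= 0. -/
theorem IsLeadingSingularVectors.two_mul_abs_le (h : IsLeadingSingularVectors A P Q)
    (hanti : ∀ i < m, sval A (i + 1) < sval A i) (x : Fin dx → ℝ) {y : Fin dy → ℝ}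
    (hy : Qᵀ *ᵥ y = 0) : 2 * |x ⬝ᵥ A *ᵥ y| ≤ sval A m * (x ⬝ᵥ x + y ⬝ᵥ y) := by
  have h1 := h.dotProduct_mulVec_le hanti y hy
  have h0 := sval_nonneg A m
  rcases h0.eq_or_lt with h2 | h2
  · rw [← h2] at h1 ⊢
    have h3 : (A *ᵥ y) ⬝ᵥ (A *ᵥ y) = 0 :=
      le_antisymm (by simpa using h1) (Finset.sum_nonneg fun i _ => mul_self_nonneg _)
    rw [dotProduct_self_eq_zero.1 h3]
    simp
  · have key : ∀ e : ℝ, 0 ≤ sval A m ^ 2 * (x ⬝ᵥ x) + 2 * e * sval A m * (x ⬝ᵥ A *ᵥ y)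
        + e ^ 2 * ((A *ᵥ y) ⬝ᵥ (A *ᵥ y)) := by
      intro e
      have h3 : 0 ≤ (sval A m • x + e • A *ᵥ y) ⬝ᵥ (sval A m • x + e • A *ᵥ y) :=
        Finset.sum_nonneg fun i _ => mul_self_nonneg _
      simp only [add_dotProduct, dotProduct_add, smul_dotProduct, dotProduct_smul, smul_eq_mul,
        dotProduct_comm (A *ᵥ y) x] at h3
      linarith
    have h4 := key 1
    have h5 := key (-1)
    rcases abs_cases (x ⬝ᵥ A *ᵥ y) with ⟨h6, -⟩ | ⟨h6, -⟩ <;> rw [h6] <;>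
      refine le_of_mul_le_mul_left ?_ h2 <;> linarith

/-- A pair of vectors splits into its part along the leading singular vectors and a remainder on
which `A` is bounded by the next singular value. -/
theorem IsLeadingSingularVectors.decomp (h : IsLeadingSingularVectors A P Q)
    (hanti : ∀ i < m, sval A (i + 1) < sval A i) (x : Fin dx → ℝ) (y : Fin dy → ℝ) :
    ∃ α c : ℝ, 0 ≤ α ∧ 2 * |c| ≤ sval A m * α ∧
      x ⬝ᵥ x + y ⬝ᵥ y = ∑ i : Fin m, ((Pᵀ *ᵥ x) i ^ 2 + (Qᵀ *ᵥ y) i ^ 2) + α ∧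
      x ⬝ᵥ A *ᵥ y = ∑ i : Fin m, sval A i * ((Pᵀ *ᵥ x) i * (Qᵀ *ᵥ y) i) + c := by
  obtain ⟨hP, hQ, hAQ, hAP⟩ := id h
  set x' := x - P *ᵥ (Pᵀ *ᵥ x) with hx'
  set y' := y - Q *ᵥ (Qᵀ *ᵥ y) with hy'
  have hQy : Qᵀ *ᵥ y' = 0 := by
    rw [hy', Matrix.mulVec_sub, Matrix.mulVec_mulVec (Qᵀ *ᵥ y), hQ, Matrix.one_mulVec, sub_self]
  have hPA : Pᵀ * A = Matrix.diagonal (fun i : Fin m => sval A i) * Qᵀ := by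
    have := congrArg Matrix.transpose hAP
    simpa [Matrix.transpose_mul] using this
  refine ⟨x' ⬝ᵥ x' + y' ⬝ᵥ y', x' ⬝ᵥ A *ᵥ y',
    add_nonneg (Finset.sum_nonneg fun i _ => mul_self_nonneg _)
      (Finset.sum_nonneg fun i _ => mul_self_nonneg _), h.two_mul_abs_le hanti x' hQy, ?_, ?_⟩
  · rw [dotProduct_self_decomp hP x, dotProduct_self_decomp hQ y, Finset.sum_add_distrib]
    simp only [dotProduct, sq]
    ring
  · have h1 : A *ᵥ y = A *ᵥ y' + P *ᵥ (Matrix.diagonal (fun i : Fin m => sval A i) *ᵥ (Qᵀ *ᵥ y)) := by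
      rw [hy', Matrix.mulVec_sub, Matrix.mulVec_mulVec (Qᵀ *ᵥ y), hAQ, ← Matrix.mulVec_mulVec,
        sub_add_cancel]
    have h2 : (P *ᵥ (Pᵀ *ᵥ x)) ⬝ᵥ A *ᵥ y' = 0 := by
      rw [Matrix.dotProduct_mulVec, Matrix.vecMul_mulVec, ← Matrix.dotProduct_mulVec, hPA,
        ← Matrix.mulVec_mulVec, hQy, Matrix.mulVec_zero, dotProduct_zero]
    have h3 : x ⬝ᵥ P *ᵥ (Matrix.diagonal (fun i : Fin m => sval A i) *ᵥ (Qᵀ *ᵥ y))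
        = ∑ i : Fin m, sval A i * ((Pᵀ *ᵥ x) i * (Qᵀ *ᵥ y) i) := by
      rw [Matrix.dotProduct_mulVec, ← Matrix.mulVec_transpose, dotProduct]
      refine Finset.sum_congr rfl fun i _ => ?_
      rw [Matrix.mulVec_diagonal]
      ring
    rw [h1, dotProduct_add, h3, hx', sub_dotProduct, h2]
    ring

theorem sum_sum_nonneg_of_symm {F : Fin m → Fin m → ℝ} (hF : ∀ i j, 0 ≤ F i j + F j i) :
    0 ≤ ∑ j, ∑ i, F i j := by
  have h1 : 0 ≤ ∑ j, ∑ i, (F i j + F j i) :=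
    Finset.sum_nonneg fun j _ => Finset.sum_nonneg fun i _ => hF i j
  simp only [Finset.sum_add_distrib] at h1
  rw [Finset.sum_comm (f := fun j i => F j i)] at h1
  linarith

variable {mu s : Fin m → ℝ} {a : Fin m → Fin dx → ℝ} {b : Fin m → Fin dy → ℝ}

/-- A common form of the two bounds of the Hessian by multiples of the metric: `e = -1` gives the
lower one and `e = 1` the upper one. -/
theorem IsLeadingSingularVectors.form_nonneg (h : IsLeadingSingularVectors A P Q)
    (hanti : ∀ i < m, sval A (i + 1) < sval A i) (hmu : ∀ i, 0 < mu i) (ha : IsSkewAgainst P a)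
    (hb : IsSkewAgainst Q b) {K e : ℝ} (he : e ^ 2 = 1)
    (h1 : ∀ i j, i ≠ j → 0 ≤ e * (K * (s i + s j)
      - (mu i + e * mu j) * (sval A i + e * sval A j)))
    (h2 : ∀ i, 0 ≤ e * (K * s i - mu i * (sval A i + e * sval A m))) :
    0 ≤ e * (K * metricForm s a a b b - hessForm A mu (fun i => sval A i) a a b b) := by
  choose α c hα hc hn hd using fun l => h.decomp hanti (a l) (b l)
  have he' : |e| = 1 := by
    have := sq_abs e
    rw [he] at this
    exact (pow_eq_one_iff_of_nonneg (abs_nonneg e) two_ne_zero).1 this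
  -- `F i j` is the contribution of the component of column `j` along the `i`-th singular pair. Only
  -- `F i j + F j i` has a sign; diagonal terms vanish by skewness.
  let F : Fin m → Fin m → ℝ := fun i j =>
    e * (K * s j - mu j * sval A j) * ((Pᵀ *ᵥ a j) i ^ 2 + (Qᵀ *ᵥ b j) i ^ 2)
      + 2 * e * mu j * (sval A i * ((Pᵀ *ᵥ a j) i * (Qᵀ *ᵥ b j) i))
  have hF : ∀ i j, 0 ≤ F i j + F j i := by
    intro i j
    simp only [F]
    rw [ha j i, hb j i]
    rcases eq_or_ne i j with rfl | hij
    · have h3 : (Pᵀ *ᵥ a i) i = 0 := by linarith [ha i i]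
      have h4 : (Qᵀ *ᵥ b i) i = 0 := by linarith [hb i i]
      simp [h3, h4]
    · set x := (Pᵀ *ᵥ a j) i
      set y := (Qᵀ *ᵥ b j) i
      have h3 := mul_nonneg (h1 i j hij) (add_nonneg (sq_nonneg x) (sq_nonneg y))
      have h4 : 0 ≤ mu i * sval A j + mu j * sval A i :=
        add_nonneg (mul_nonneg (hmu i).le (sval_nonneg A j))
          (mul_nonneg (hmu j).le (sval_nonneg A i))
      -- For fixed (i, j), the contribution is the hypothesis `h1` times x² + y² plus this square,
      -- whose vanishing at x = -e y marks the extremal direction.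
      have h5 := mul_nonneg h4 (sq_nonneg (x + e * y))
      have h6 : (x + e * y) ^ 2 = x ^ 2 + 2 * e * x * y + y ^ 2 := by
        linear_combination y ^ 2 * he
      rw [h6] at h5
      have h7 : e * (K * (s i + s j) - (mu i + e * mu j) * (sval A i + e * sval A j))
          = e * (K * (s i + s j)) - e * (mu i * sval A i) - (mu i * sval A j + mu j * sval A i)
            - e * (mu j * sval A j) := by
        linear_combination (-(mu i * sval A j + mu j * sval A i) - e * (mu j * sval A j)) * he
      rw [h7] at h3
      linarith
  have hsum := sum_sum_nonneg_of_symm hF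
  have hrest : 0 ≤ ∑ j, (e * (K * s j - mu j * sval A j) * α j + 2 * e * mu j * c j) := by
    refine Finset.sum_nonneg fun j _ => ?_
    have h3 := mul_nonneg (h2 j) (hα j)
    have h4 : |2 * e * c j| ≤ sval A m * α j := by
      rw [abs_mul, abs_mul, he', mul_one, abs_two]
      exact hc j
    have h5 := mul_le_mul_of_nonneg_left (neg_le_of_abs_le h4) (hmu j).le
    have h6 : e * (K * s j - mu j * (sval A j + e * sval A m))
        = e * (K * s j - mu j * sval A j) - mu j * sval A m := by
      linear_combination (-(mu j * sval A m)) * he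
    rw [h6] at h3
    linarith
  have htot : e * (K * metricForm s a a b b - hessForm A mu (fun i => sval A i) a a b b)
      = ∑ j, ∑ i, F i j
        + ∑ j, (e * (K * s j - mu j * sval A j) * α j + 2 * e * mu j * c j) := by
    rw [metricForm, hessForm, Finset.mul_sum, ← Finset.sum_sub_distrib, Finset.mul_sum,
      ← Finset.sum_add_distrib]
    refine Finset.sum_congr rfl fun j _ => ?_
    simp only [F]
    rw [Finset.sum_add_distrib, ← Finset.mul_sum, ← Finset.mul_sum, hn j, hd j]
    ring
  rw [htot]
  exact add_nonneg hsum hrest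

/-- Eigenvectors that rotate the leading singular vectors. -/
theorem IsLeadingSingularVectors.exists_rotation (h : IsLeadingSingularVectors A P Q) {i j : Fin m}
    (hij : i ≠ j) {e r : ℝ} (he : e ^ 2 = 1)
    (hr : r * (s i + s j) = (mu i + e * mu j) * (sval A i + e * sval A j)) :
    ∃ (a : Fin m → Fin dx → ℝ) (b : Fin m → Fin dy → ℝ), a ≠ 0 ∧ IsSkewAgainst P a ∧
      IsSkewAgainst Q b ∧ ∀ a' b', IsSkewAgainst P a' → IsSkewAgainst Q b' →
        hessForm A mu (fun i => sval A i) a a' b b' = r * metricForm s a a' b b' := by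
  obtain ⟨hP, hQ, hAQ, hAP⟩ := id h
  have hcol : ∀ {d : ℕ} {P : Matrix (Fin d) (Fin m) ℝ}, Pᵀ * P = 1 → ∀ k l,
      (Pᵀ *ᵥ Pᵀ k) l = if l = k then 1 else 0 := by
    intro d P hP k l
    have := congrFun (congrFun hP l) k
    rwa [Matrix.one_apply, Matrix.mul_apply] at this
  have hskew : ∀ {d : ℕ} {P : Matrix (Fin d) (Fin m) ℝ}, Pᵀ * P = 1 → ∀ t : ℝ,
      IsSkewAgainst P (fun l => if l = j then t • Pᵀ i else if l = i then -t • Pᵀ j else 0) := by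
    intro d P hP t k l
    simp only [apply_ite (fun x => Pᵀ *ᵥ x), Matrix.mulVec_smul, Matrix.mulVec_zero, ite_apply,
      Pi.smul_apply, Pi.zero_apply, hcol hP]
    split_ifs <;> simp_all
  have hAv : ∀ k, A *ᵥ Qᵀ k = sval A k • Pᵀ k := by
    intro k
    ext l
    have := congrFun (congrFun hAQ l) k
    rw [Matrix.mul_diagonal, Matrix.mul_apply] at this
    rw [Matrix.mulVec, dotProduct, Pi.smul_apply, smul_eq_mul, mul_comm]
    exact this
  have hAu : ∀ k, Aᵀ *ᵥ Pᵀ k = sval A k • Qᵀ k := by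
    intro k
    ext l
    have := congrFun (congrFun hAP l) k
    rw [Matrix.mul_diagonal, Matrix.mul_apply] at this
    rw [Matrix.mulVec, dotProduct, Pi.smul_apply, smul_eq_mul, mul_comm]
    exact this
  -- The same infinitesimal rotation of columns `i` and `j` is applied on both sides, with relative
  -- factor `-e` on the right: the equality case of the two-by-two form.
  refine ⟨fun l => if l = j then (1 : ℝ) • Pᵀ i else if l = i then -(1 : ℝ) • Pᵀ j else 0,
    fun l => if l = j then (-e) • Qᵀ i else if l = i then -(-e) • Qᵀ j else 0, ?_, hskew hP 1,
    hskew hQ (-e), fun a' b' ha' hb' => ?_⟩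
  · intro h0
    have h1 := congrFun h0 j
    simp only [if_true, one_smul, Pi.zero_apply] at h1
    have h2 := hcol hP i i
    simp [h1] at h2
  · have h1 : ∀ k l, Pᵀ k ⬝ᵥ A *ᵥ b' l = sval A k * (Qᵀ *ᵥ b' l) k := fun k l => by
      rw [Matrix.dotProduct_mulVec, ← Matrix.mulVec_transpose, hAu, smul_dotProduct, smul_eq_mul]
      rfl
    have h2 : ∀ k l, Pᵀ k ⬝ᵥ a' l = (Pᵀ *ᵥ a' l) k := fun _ _ => rfl
    have h3 : ∀ k l, Qᵀ k ⬝ᵥ b' l = (Qᵀ *ᵥ b' l) k := fun _ _ => rfl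
    have h4 : ∀ k l, a' l ⬝ᵥ Pᵀ k = (Pᵀ *ᵥ a' l) k := fun _ _ => dotProduct_comm _ _
    rw [hessForm, metricForm, Fintype.sum_eq_add i j hij, Fintype.sum_eq_add i j hij]
    · simp only [if_true, if_neg hij, smul_dotProduct, dotProduct_smul, Matrix.mulVec_smul, h1, h2,
        h3, h4, hAv, smul_eq_mul, ha' j i, hb' j i]
      linear_combination
        ((mu i * sval A j + mu j * sval A i + e * mu j * sval A j) * (Qᵀ *ᵥ b' j) i
          - mu j * sval A j * (Pᵀ *ᵥ a' j) i) * he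
        - ((Pᵀ *ᵥ a' j) i - e * (Qᵀ *ᵥ b' j) i) * hr
    · intro l hl
      simp [hl.1, hl.2]
    · intro l hl
      simp [hl.1, hl.2]

/-- Eigenvectors that move one leading singular vector towards the next one. -/
theorem IsLeadingSingularVectors.exists_exchange (h : IsLeadingSingularVectors A P Q)
    (hanti : ∀ i < m, sval A (i + 1) < sval A i) (hm : m < dy) (i : Fin m) {e r : ℝ}
    (he : e ^ 2 = 1) (hr : r * s i = mu i * (sval A i + e * sval A m)) :
    ∃ (a : Fin m → Fin dx → ℝ) (b : Fin m → Fin dy → ℝ), b ≠ 0 ∧ IsSkewAgainst P a ∧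
      IsSkewAgainst Q b ∧ ∀ a' b',
        hessForm A mu (fun i => sval A i) a a' b b' = r * metricForm s a a' b b' := by
  obtain ⟨u, v, hv, hPu, hQv, hAv, hAu⟩ := h.exists_next hanti hm
  -- Nontriviality is read off the right component because `u` may be zero.
  refine ⟨Pi.single i (-e • u), Pi.single i v, by simpa using hv, ?_, ?_, ?_⟩
  · have : ∀ j, Pᵀ *ᵥ (Pi.single i (-e • u) : Fin m → Fin dx → ℝ) j = 0 := fun j => by
      rcases eq_or_ne j i with rfl | hj
      · rw [Pi.single_eq_same, Matrix.mulVec_smul, hPu, smul_zero]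
      · rw [Pi.single_eq_of_ne hj, Matrix.mulVec_zero]
    exact fun k l => by rw [this, this, Pi.zero_apply, Pi.zero_apply, neg_zero]
  · have : ∀ j, Qᵀ *ᵥ (Pi.single i v : Fin m → Fin dy → ℝ) j = 0 := fun j => by
      rcases eq_or_ne j i with rfl | hj
      · rw [Pi.single_eq_same, hQv]
      · rw [Pi.single_eq_of_ne hj, Matrix.mulVec_zero]
    exact fun k l => by rw [this, this, Pi.zero_apply, Pi.zero_apply, neg_zero]
  · intro a' b'
    rw [hessForm, metricForm, Finset.sum_eq_single i, Finset.sum_eq_single i]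
    · have h1 : u ⬝ᵥ A *ᵥ b' i = sval A m * (v ⬝ᵥ b' i) := by
        rw [Matrix.dotProduct_mulVec, ← Matrix.mulVec_transpose, hAu, smul_dotProduct, smul_eq_mul]
      rw [Pi.single_eq_same, Pi.single_eq_same, smul_dotProduct, smul_dotProduct, h1, hAv,
        dotProduct_smul, dotProduct_comm (a' i) u]
      simp only [smul_eq_mul]
      linear_combination (mu i * sval A m * (u ⬝ᵥ a' i)) * he
        - (-e * (u ⬝ᵥ a' i) + v ⬝ᵥ b' i) * hr
    · intro l _ hl
      simp [Pi.single_eq_of_ne hl]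
    · simp
    · intro l _ hl
      simp [Pi.single_eq_of_ne hl]
    · simp

end Whitened

/-! ### Derivatives of the cost function and of the tangent projection -/

section Derivatives

variable {dx dy m : ℕ} {Sxx : Matrix (Fin dx) (Fin dx) ℝ} {Syy : Matrix (Fin dy) (Fin dy) ℝ}
  (Sxy : Matrix (Fin dx) (Fin dy) ℝ) (mu : Fin m → ℝ)

theorem contDiff_cost : ContDiff ℝ ∞ (cost Sxy mu) :=
  (contDiff_matrix_trace (contDiff_matrix_mul (contDiff_matrix_mul (contDiff_matrix_mul
    (contDiff_matrix_transpose contDiff_fst) contDiff_const) contDiff_snd) contDiff_const)).neg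

theorem fderiv_cost (p h : Matrix (Fin dx) (Fin m) ℝ × Matrix (Fin dy) (Fin m) ℝ) :
    fderiv ℝ (cost Sxy mu) p h = -(h.1ᵀ * Sxy * p.2 * Matrix.diagonal mu).trace
      - (p.1ᵀ * Sxy * h.2 * Matrix.diagonal mu).trace := by
  refine fderiv_of_quadratic (a := cost Sxy mu p) (c := cost Sxy mu h)
    ((contDiff_cost Sxy mu).differentiable (by simp) p) fun t => ?_
  simp only [cost, Prod.fst_add, Prod.snd_add, Prod.smul_fst, Prod.smul_snd, Matrix.transpose_add,
    Matrix.transpose_smul, Matrix.add_mul, Matrix.mul_add, Matrix.smul_mul, Matrix.mul_smul,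
    Matrix.trace_add, Matrix.trace_smul, smul_eq_mul]
  ring

theorem fderiv_fderiv_cost (p η ζ : Matrix (Fin dx) (Fin m) ℝ × Matrix (Fin dy) (Fin m) ℝ) :
    fderiv ℝ (fun y => fderiv ℝ (cost Sxy mu) y ζ) p η =
      -(ζ.1ᵀ * Sxy * η.2 * Matrix.diagonal mu).trace
        - (η.1ᵀ * Sxy * ζ.2 * Matrix.diagonal mu).trace := by
  have hd : ContDiff ℝ ∞ (fun y => fderiv ℝ (cost Sxy mu) y ζ) :=
    ((contDiff_cost Sxy mu).fderiv_right (m := ∞) (by simp)).clm_apply contDiff_const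
  refine fderiv_of_quadratic (a := fderiv ℝ (cost Sxy mu) p ζ) (c := 0)
    (hd.differentiable (by simp) p) fun t => ?_
  simp only [fderiv_cost, Prod.fst_add, Prod.snd_add, Prod.smul_fst, Prod.smul_snd,
    Matrix.transpose_add, Matrix.transpose_smul, Matrix.add_mul, Matrix.mul_add, Matrix.smul_mul,
    Matrix.mul_smul, Matrix.trace_add, Matrix.trace_smul, smul_eq_mul]
  ring

/-- The projection is quadratic in the base point. For `ζ` tangent at `p` the first term of each
component vanishes, leaving the curvature correction -U sym(ηᵀSζ). -/
theorem fderiv_prodProj (hSxx : Sxx.PosDef) (hSyy : Syy.PosDef)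
    (p η ζ : Matrix (Fin dx) (Fin m) ℝ × Matrix (Fin dy) (Fin m) ℝ) :
    fderiv ℝ (fun y => prodProj Sxx Syy y ζ) p η =
      (-(η.1 * symPart (p.1ᵀ * Sxx * ζ.1)) - p.1 * symPart (η.1ᵀ * Sxx * ζ.1),
        -(η.2 * symPart (p.2ᵀ * Syy * ζ.2)) - p.2 * symPart (η.2ᵀ * Syy * ζ.2)) := by
  have hd := (isTangentProj_prodProj (m := m) hSxx hSyy).contDiff_apply ζ
  refine fderiv_of_quadratic (a := prodProj Sxx Syy p ζ)
    (c := (-(η.1 * symPart (η.1ᵀ * Sxx * ζ.1)), -(η.2 * symPart (η.2ᵀ * Syy * ζ.2))))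
    (hd.differentiable (by simp) p) fun t => ?_
  have key : ∀ {d : ℕ} (S : Matrix (Fin d) (Fin d) ℝ) (U ξ Z : Matrix (Fin d) (Fin m) ℝ),
      Z - (U + t • ξ) * symPart ((U + t • ξ)ᵀ * S * Z) = Z - U * symPart (Uᵀ * S * Z)
        + t • (-(ξ * symPart (Uᵀ * S * Z)) - U * symPart (ξᵀ * S * Z))
        + t ^ 2 • (-(ξ * symPart (ξᵀ * S * Z))) := by
    intro d S U ξ Z
    simp only [Matrix.transpose_add, Matrix.transpose_smul, Matrix.add_mul, Matrix.mul_add,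
      Matrix.smul_mul, Matrix.mul_smul, symPart_add, symPart_smul]
    module
  exact Prod.ext (key Sxx p.1 η.1 ζ.1) (key Syy p.2 η.2 ζ.2)

end Derivatives

/-! ### Whitening -/

theorem trace_mul_diagonal {d d' m : ℕ} (B : Matrix (Fin d) (Fin d') ℝ)
    (X : Matrix (Fin d) (Fin m) ℝ) (Y : Matrix (Fin d') (Fin m) ℝ) (w : Fin m → ℝ) :
    (Xᵀ * B * Y * Matrix.diagonal w).trace = ∑ l, w l * (Xᵀ l ⬝ᵥ B *ᵥ Yᵀ l) := by
  rw [Matrix.trace]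
  refine Finset.sum_congr rfl fun l _ => ?_
  rw [Matrix.diag_apply, Matrix.mul_diagonal, mul_comm, Matrix.mul_assoc]
  rfl

theorem trace_symPart_mul_diagonal {k : ℕ} (X : Matrix (Fin k) (Fin k) ℝ) (w : Fin k → ℝ) :
    (symPart X * Matrix.diagonal w).trace = (X * Matrix.diagonal w).trace := by
  simp only [Matrix.trace, Matrix.diag_apply, Matrix.mul_diagonal]
  refine Finset.sum_congr rfl fun l _ => ?_
  simp only [symPart, Matrix.smul_apply, Matrix.add_apply, Matrix.transpose_apply, smul_eq_mul]
  ring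

theorem symPart_eq_zero_iff {k : ℕ} {X : Matrix (Fin k) (Fin k) ℝ} :
    symPart X = 0 ↔ ∀ i j, X i j = -X j i := by
  rw [← Matrix.ext_iff]
  refine forall_congr' fun i => forall_congr' fun j => ?_
  simp [symPart]
  constructor <;> intro h <;> linarith

theorem trace_mul_diagonal_of_symPart_eq_zero {k : ℕ} {X : Matrix (Fin k) (Fin k) ℝ}
    (hX : symPart X = 0) (w : Fin k → ℝ) : (X * Matrix.diagonal w).trace = 0 := by
  rw [← trace_symPart_mul_diagonal, hX, Matrix.zero_mul, Matrix.trace_zero]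

theorem msqrt_mul_inv {k : ℕ} {S : Matrix (Fin k) (Fin k) ℝ} (hS : S.PosDef) :
    msqrt S * (msqrt S)⁻¹ = 1 :=
  Matrix.mul_nonsing_inv _ ((Matrix.isUnit_iff_isUnit_det _).1 (msqrt_posDef hS).isUnit)

theorem msqrt_inv_mul {k : ℕ} {S : Matrix (Fin k) (Fin k) ℝ} (hS : S.PosDef) :
    (msqrt S)⁻¹ * msqrt S = 1 :=
  Matrix.nonsing_inv_mul _ ((Matrix.isUnit_iff_isUnit_det _).1 (msqrt_posDef hS).isUnit)

theorem msqrt_inv_transpose {k : ℕ} (S : Matrix (Fin k) (Fin k) ℝ) :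
    ((msqrt S)⁻¹)ᵀ = (msqrt S)⁻¹ := by
  rw [Matrix.transpose_nonsing_inv, msqrt_transpose]

theorem msqrt_diagonal_sq_add {k : ℕ} (w : Fin k → ℝ) {delta : ℝ} (hdelta : 0 < delta) :
    msqrt (Matrix.diagonal w ^ 2 + delta • (1 : Matrix (Fin k) (Fin k) ℝ))
      = Matrix.diagonal fun i => √(w i ^ 2 + delta) := by
  refine msqrt_eq (Matrix.PosSemidef.diagonal fun i => Real.sqrt_nonneg _) ?_
  rw [Matrix.diagonal_mul_diagonal, sq, Matrix.diagonal_mul_diagonal, ← Matrix.diagonal_one,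
    ← Matrix.diagonal_smul, Matrix.diagonal_add]
  congr 1
  ext i
  rw [Real.mul_self_sqrt (by positivity)]
  simp [sq]

section Main

variable {dx dy m : ℕ} {Sxx : Matrix (Fin dx) (Fin dx) ℝ} {Syy : Matrix (Fin dy) (Fin dy) ℝ}
  {Sxy : Matrix (Fin dx) (Fin dy) ℝ} {P : Matrix (Fin dx) (Fin m) ℝ}
  {Q : Matrix (Fin dy) (Fin m) ℝ}

theorem msqrt_inv_mul_mem_genStiefel {d : ℕ} {S : Matrix (Fin d) (Fin d) ℝ} (hS : S.PosDef)
    {P : Matrix (Fin d) (Fin m) ℝ} (hP : Pᵀ * P = 1) : (msqrt S)⁻¹ * P ∈ genStiefel m S := by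
  change ((msqrt S)⁻¹ * P)ᵀ * S * ((msqrt S)⁻¹ * P) = 1
  rw [Matrix.transpose_mul, msqrt_inv_transpose]
  calc Pᵀ * (msqrt S)⁻¹ * S * ((msqrt S)⁻¹ * P)
      = Pᵀ * (msqrt S)⁻¹ * (msqrt S * msqrt S) * ((msqrt S)⁻¹ * P) := by rw [msqrt_mul_self hS]
    _ = Pᵀ * ((msqrt S)⁻¹ * msqrt S) * (msqrt S * (msqrt S)⁻¹) * P := by
        simp only [Matrix.mul_assoc]
    _ = 1 := by rw [msqrt_inv_mul hS, msqrt_mul_inv hS, Matrix.mul_one, Matrix.mul_one, hP]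

theorem transpose_mul_mul_whiten {d : ℕ} {S : Matrix (Fin d) (Fin d) ℝ} (hS : S.PosDef)
    (P ξ : Matrix (Fin d) (Fin m) ℝ) :
    ((msqrt S)⁻¹ * P)ᵀ * S * ξ = Pᵀ * (msqrt S * ξ) := by
  rw [Matrix.transpose_mul, msqrt_inv_transpose]
  calc Pᵀ * (msqrt S)⁻¹ * S * ξ
      = Pᵀ * (msqrt S)⁻¹ * (msqrt S * msqrt S) * ξ := by rw [msqrt_mul_self hS]
    _ = Pᵀ * ((msqrt S)⁻¹ * msqrt S) * (msqrt S * ξ) := by simp only [Matrix.mul_assoc]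
    _ = _ := by rw [msqrt_inv_mul hS, Matrix.mul_one]

theorem symPart_whiten_eq_zero_iff {d : ℕ} {S : Matrix (Fin d) (Fin d) ℝ} (hS : S.PosDef)
    (P ξ : Matrix (Fin d) (Fin m) ℝ) :
    symPart (((msqrt S)⁻¹ * P)ᵀ * S * ξ) = 0 ↔ IsSkewAgainst P (msqrt S * ξ)ᵀ := by
  rw [transpose_mul_mul_whiten hS, symPart_eq_zero_iff]
  rfl

theorem whitened_eq (hSxx : Sxx.PosDef) (hSyy : Syy.PosDef) :
    Sxy = msqrt Sxx * whitened Sxx Syy Sxy * msqrt Syy := by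
  rw [whitened]
  calc Sxy = (msqrt Sxx * (msqrt Sxx)⁻¹) * Sxy * ((msqrt Syy)⁻¹ * msqrt Syy) := by
        rw [msqrt_mul_inv hSxx, msqrt_inv_mul hSyy, Matrix.one_mul, Matrix.mul_one]
    _ = _ := by simp only [Matrix.mul_assoc]

theorem trace_cross_whiten (hSxx : Sxx.PosDef) (hSyy : Syy.PosDef)
    (ξ : Matrix (Fin dx) (Fin m) ℝ) (η : Matrix (Fin dy) (Fin m) ℝ) (w : Fin m → ℝ) :
    (ξᵀ * Sxy * η * Matrix.diagonal w).trace =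
      ∑ l, w l * ((msqrt Sxx * ξ)ᵀ l ⬝ᵥ whitened Sxx Syy Sxy *ᵥ (msqrt Syy * η)ᵀ l) := by
  rw [← trace_mul_diagonal, Matrix.transpose_mul, msqrt_transpose]
  conv_lhs => rw [whitened_eq (Sxy := Sxy) hSxx hSyy]
  simp only [Matrix.mul_assoc]

theorem trace_gram_whiten {d : ℕ} {S : Matrix (Fin d) (Fin d) ℝ} (hS : S.PosDef)
    (ξ η : Matrix (Fin d) (Fin m) ℝ) (w : Fin m → ℝ) :
    (ξᵀ * S * η * Matrix.diagonal w).trace =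
      ∑ l, w l * ((msqrt S * ξ)ᵀ l ⬝ᵥ (msqrt S * η)ᵀ l) := by
  have h := trace_mul_diagonal 1 (msqrt S * ξ) (msqrt S * η) w
  simp only [Matrix.one_mulVec] at h
  rw [← h, Matrix.transpose_mul, msqrt_transpose, Matrix.mul_one]
  conv_lhs => rw [← msqrt_mul_self hS]
  simp only [Matrix.mul_assoc]

/-- The singular vector equation in the original coordinates, Sxy V* = Sxx U* Σ; it yields
criticality and the diagonal form of the preconditioners. -/
theorem mul_whitened_right (hSxx : Sxx.PosDef) (hSyy : Syy.PosDef)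
    (h : IsLeadingSingularVectors (whitened Sxx Syy Sxy) P Q) :
    Sxy * ((msqrt Syy)⁻¹ * Q) = Sxx * ((msqrt Sxx)⁻¹ * P) *
      Matrix.diagonal fun i : Fin m => sval (whitened Sxx Syy Sxy) i := by
  calc Sxy * ((msqrt Syy)⁻¹ * Q)
      = msqrt Sxx * whitened Sxx Syy Sxy * msqrt Syy * ((msqrt Syy)⁻¹ * Q) := by
        rw [← whitened_eq hSxx hSyy]
    _ = msqrt Sxx * (whitened Sxx Syy Sxy * ((msqrt Syy * (msqrt Syy)⁻¹) * Q)) := by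
        simp only [Matrix.mul_assoc]
    _ = msqrt Sxx * (msqrt Sxx * (msqrt Sxx)⁻¹ * P *
          Matrix.diagonal fun i : Fin m => sval (whitened Sxx Syy Sxy) i) := by
        rw [msqrt_mul_inv hSxx, msqrt_mul_inv hSyy, Matrix.one_mul, Matrix.one_mul, h.2.2.1]
    _ = msqrt Sxx * msqrt Sxx * ((msqrt Sxx)⁻¹ * P) *
          Matrix.diagonal fun i : Fin m => sval (whitened Sxx Syy Sxy) i := by
        simp only [Matrix.mul_assoc]
    _ = _ := by rw [msqrt_mul_self hSxx]

theorem mul_whitened_left (hSxx : Sxx.PosDef) (hSyy : Syy.PosDef)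
    (h : IsLeadingSingularVectors (whitened Sxx Syy Sxy) P Q) :
    Sxyᵀ * ((msqrt Sxx)⁻¹ * P) = Syy * ((msqrt Syy)⁻¹ * Q) *
      Matrix.diagonal fun i : Fin m => sval (whitened Sxx Syy Sxy) i := by
  calc Sxyᵀ * ((msqrt Sxx)⁻¹ * P)
      = (msqrt Sxx * whitened Sxx Syy Sxy * msqrt Syy)ᵀ * ((msqrt Sxx)⁻¹ * P) := by
        rw [← whitened_eq hSxx hSyy]
    _ = msqrt Syy * ((whitened Sxx Syy Sxy)ᵀ * ((msqrt Sxx * (msqrt Sxx)⁻¹) * P)) := by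
        simp only [Matrix.transpose_mul, msqrt_transpose, Matrix.mul_assoc]
    _ = msqrt Syy * (msqrt Syy * (msqrt Syy)⁻¹ * Q *
          Matrix.diagonal fun i : Fin m => sval (whitened Sxx Syy Sxy) i) := by
        rw [msqrt_mul_inv hSxx, msqrt_mul_inv hSyy, Matrix.one_mul, Matrix.one_mul, h.2.2.2]
    _ = msqrt Syy * msqrt Syy * ((msqrt Syy)⁻¹ * Q) *
          Matrix.diagonal fun i : Fin m => sval (whitened Sxx Syy Sxy) i := by
        simp only [Matrix.mul_assoc]
    _ = _ := by rw [msqrt_mul_self hSyy]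

theorem cross_eq_diagonal (hSxx : Sxx.PosDef) (hSyy : Syy.PosDef)
    (h : IsLeadingSingularVectors (whitened Sxx Syy Sxy) P Q) :
    ((msqrt Sxx)⁻¹ * P)ᵀ * Sxy * ((msqrt Syy)⁻¹ * Q) =
      Matrix.diagonal fun i : Fin m => sval (whitened Sxx Syy Sxy) i := by
  have h1 : ((msqrt Sxx)⁻¹ * P)ᵀ * Sxx * ((msqrt Sxx)⁻¹ * P) = 1 :=
    msqrt_inv_mul_mem_genStiefel hSxx h.1
  rw [Matrix.mul_assoc, mul_whitened_right hSxx hSyy h, ← Matrix.mul_assoc, ← Matrix.mul_assoc, h1,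
    Matrix.one_mul]

theorem rightPrec_eq_diagonal {U : Matrix (Fin dx) (Fin m) ℝ} {V : Matrix (Fin dy) (Fin m) ℝ}
    {w : Fin m → ℝ} (hUV : Uᵀ * Sxy * V = Matrix.diagonal w) (mu : Fin m → ℝ) {delta : ℝ}
    (hdelta : 0 < delta) :
    rightPrec Sxy mu delta U V = Matrix.diagonal fun i => √(mu i ^ 2 * w i ^ 2 + delta) := by
  rw [rightPrec, hUV, Matrix.diagonal_mul_diagonal,
    symPart_of_transpose_eq (Matrix.diagonal_transpose _), msqrt_diagonal_sq_add _ hdelta]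
  simp only [mul_pow, mul_comm]

theorem newMetric_whiten (hSxx : Sxx.PosDef) (hSyy : Syy.PosDef)
    (h : IsLeadingSingularVectors (whitened Sxx Syy Sxy) P Q) (mu : Fin m → ℝ) {delta : ℝ}
    (hdelta : 0 < delta) (ξ η : Matrix (Fin dx) (Fin m) ℝ × Matrix (Fin dy) (Fin m) ℝ) :
    newMetric Sxx Syy Sxy mu delta ((msqrt Sxx)⁻¹ * P, (msqrt Syy)⁻¹ * Q) ξ η =
      metricForm (fun i : Fin m => √(mu i ^ 2 * sval (whitened Sxx Syy Sxy) i ^ 2 + delta))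
        (msqrt Sxx * ξ.1)ᵀ (msqrt Sxx * η.1)ᵀ (msqrt Syy * ξ.2)ᵀ (msqrt Syy * η.2)ᵀ := by
  have h1 := cross_eq_diagonal hSxx hSyy h
  have h2 : ((msqrt Syy)⁻¹ * Q)ᵀ * Sxyᵀ * ((msqrt Sxx)⁻¹ * P) =
      Matrix.diagonal fun i : Fin m => sval (whitened Sxx Syy Sxy) i := by
    rw [← Matrix.diagonal_transpose, ← h1]
    simp only [Matrix.transpose_mul, Matrix.transpose_transpose, Matrix.mul_assoc]
  rw [newMetric_apply, rightPrec_eq_diagonal h1 mu hdelta, rightPrec_eq_diagonal h2 mu hdelta,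
    ← Matrix.mul_assoc, ← Matrix.mul_assoc, ← Matrix.mul_assoc, ← Matrix.mul_assoc,
    trace_gram_whiten hSxx, trace_gram_whiten hSyy, ← Finset.sum_add_distrib]
  exact Finset.sum_congr rfl fun l _ => (mul_add _ _ _).symm

/-- The singular vector equations reduce the derivative to traces of skew-symmetric matrices against
diagonal ones. -/
theorem fderiv_cost_eq_zero (hSxx : Sxx.PosDef) (hSyy : Syy.PosDef)
    (h : IsLeadingSingularVectors (whitened Sxx Syy Sxy) P Q) (mu : Fin m → ℝ)
    {η : Matrix (Fin dx) (Fin m) ℝ × Matrix (Fin dy) (Fin m) ℝ}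
    (h1 : symPart (((msqrt Sxx)⁻¹ * P)ᵀ * Sxx * η.1) = 0)
    (h2 : symPart (((msqrt Syy)⁻¹ * Q)ᵀ * Syy * η.2) = 0) :
    fderiv ℝ (cost Sxy mu) ((msqrt Sxx)⁻¹ * P, (msqrt Syy)⁻¹ * Q) η = 0 := by
  have key : ∀ {d : ℕ} {S : Matrix (Fin d) (Fin d) ℝ}, S.PosDef →
      ∀ U ξ : Matrix (Fin d) (Fin m) ℝ, symPart (Uᵀ * S * ξ) = 0 → ∀ w : Fin m → ℝ,
        (ξᵀ * (S * U * Matrix.diagonal w) * Matrix.diagonal mu).trace = 0 := by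
    intro d S hS U ξ hξ w
    have h3 : (ξᵀ * (S * U * Matrix.diagonal w) * Matrix.diagonal mu)
        = (Uᵀ * S * ξ)ᵀ * Matrix.diagonal fun i => w i * mu i := by
      rw [← Matrix.diagonal_mul_diagonal]
      simp only [Matrix.transpose_mul, Matrix.transpose_transpose, posDef_transpose hS,
        Matrix.mul_assoc]
    rw [h3]
    refine trace_mul_diagonal_of_symPart_eq_zero ?_ _
    rw [← hξ, symPart, symPart, Matrix.transpose_transpose, add_comm]
  have h4 : (((msqrt Sxx)⁻¹ * P)ᵀ * Sxy * η.2 * Matrix.diagonal mu).trace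
      = (η.2ᵀ * (Sxyᵀ * ((msqrt Sxx)⁻¹ * P)) * Matrix.diagonal mu).trace := by
    rw [← Matrix.trace_transpose, Matrix.trace_mul_comm _ (Matrix.diagonal mu)]
    simp only [Matrix.transpose_mul, Matrix.transpose_transpose, Matrix.mul_assoc,
      Matrix.diagonal_transpose]
  rw [fderiv_cost, h4, Matrix.mul_assoc η.1ᵀ, mul_whitened_right hSxx hSyy h,
    mul_whitened_left hSxx hSyy h, key hSxx _ _ h1, key hSyy _ _ h2]
  simp

/-- The second derivative of the cost gives the cross terms with `A`; the derivative of the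
projection gives the terms μ_lσ_l(a_l·a'_l + b_l·b'_l), because U*ᵀ Sxy V* is diagonal. -/
theorem hessian_whiten (hSxx : Sxx.PosDef) (hSyy : Syy.PosDef)
    (h : IsLeadingSingularVectors (whitened Sxx Syy Sxy) P Q) (mu : Fin m → ℝ)
    {η ζ : Matrix (Fin dx) (Fin m) ℝ × Matrix (Fin dy) (Fin m) ℝ}
    (h1 : symPart (((msqrt Sxx)⁻¹ * P)ᵀ * Sxx * ζ.1) = 0)
    (h2 : symPart (((msqrt Syy)⁻¹ * Q)ᵀ * Syy * ζ.2) = 0) :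
    fderiv ℝ (fun y => fderiv ℝ (cost Sxy mu) y ζ) ((msqrt Sxx)⁻¹ * P, (msqrt Syy)⁻¹ * Q) η
      + fderiv ℝ (cost Sxy mu) ((msqrt Sxx)⁻¹ * P, (msqrt Syy)⁻¹ * Q)
        (fderiv ℝ (fun y => prodProj Sxx Syy y ζ) ((msqrt Sxx)⁻¹ * P, (msqrt Syy)⁻¹ * Q) η) =
      hessForm (whitened Sxx Syy Sxy) mu (fun i => sval (whitened Sxx Syy Sxy) i)
        (msqrt Sxx * η.1)ᵀ (msqrt Sxx * ζ.1)ᵀ (msqrt Syy * η.2)ᵀ (msqrt Syy * ζ.2)ᵀ := by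
  have hc := cross_eq_diagonal hSxx hSyy h
  rw [fderiv_fderiv_cost, fderiv_prodProj hSxx hSyy, fderiv_cost]
  simp only [h1, h2, Matrix.mul_zero, neg_zero, zero_sub, Matrix.transpose_neg, Matrix.neg_mul,
    Matrix.mul_neg, Matrix.trace_neg, neg_neg, sub_neg_eq_add]
  have h3 : ∀ X : Matrix (Fin m) (Fin m) ℝ,
      ((((msqrt Sxx)⁻¹ * P) * symPart X)ᵀ * Sxy * ((msqrt Syy)⁻¹ * Q) * Matrix.diagonal mu).trace
        = (X * Matrix.diagonal fun i : Fin m => mu i * sval (whitened Sxx Syy Sxy) i).trace := by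
    intro X
    rw [← trace_symPart_mul_diagonal X, Matrix.transpose_mul, symPart_transpose, Matrix.mul_assoc,
      Matrix.mul_assoc, Matrix.mul_assoc, ← Matrix.mul_assoc (((msqrt Sxx)⁻¹ * P)ᵀ),
      ← Matrix.mul_assoc (((msqrt Sxx)⁻¹ * P)ᵀ * Sxy), hc, Matrix.diagonal_mul_diagonal]
    simp only [mul_comm]
  have h4 : ∀ X : Matrix (Fin m) (Fin m) ℝ,
      (((msqrt Sxx)⁻¹ * P)ᵀ * Sxy * (((msqrt Syy)⁻¹ * Q) * symPart X) * Matrix.diagonal mu).trace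
        = (X * Matrix.diagonal fun i : Fin m => mu i * sval (whitened Sxx Syy Sxy) i).trace := by
    intro X
    rw [← trace_symPart_mul_diagonal X, ← Matrix.mul_assoc, hc, Matrix.mul_assoc,
      Matrix.trace_mul_comm, Matrix.mul_assoc, Matrix.diagonal_mul_diagonal]
  rw [h3, h4, trace_gram_whiten hSxx, trace_gram_whiten hSyy, trace_cross_whiten hSxx hSyy,
    trace_cross_whiten hSxx hSyy]
  unfold hessForm
  simp only [← Finset.sum_add_distrib, ← Finset.sum_sub_distrib, ← Finset.sum_neg_distrib]
  refine Finset.sum_congr rfl fun l _ => ?_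
  ring

end Main

end CCA

/-! ### From attained spectral bounds to the condition number -/

namespace EmbeddedRiem

/-- Eigenvalues that bound the Hessian from below and from above are the extreme eigenvalues and the
extreme values of the Rayleigh quotient. -/
theorem condNumber_eq_of_extreme {E : Type*} [NormedAddCommGroup E] [NormedSpace ℝ E] {M : Set E}
    {g : E → LinearMap.BilinForm ℝ E} {f : E → ℝ} {x : E} (hpos : ∀ v, v ≠ 0 → 0 < g x v v)
    {L K : ℝ} (hL : L ∈ hessEigenvalues M g f x) (hK : K ∈ hessEigenvalues M g f x)
    (hbL : ∀ η ∈ tangentSpace M x, L * g x η η ≤ g x η (riemHess M g f x η))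
    (hbK : ∀ η ∈ tangentSpace M x, g x η (riemHess M g f x η) ≤ K * g x η η) :
    condNumber M g f x = K / L ∧
      sSup (rayleighValues M g f x) / sInf (rayleighValues M g f x) = K / L := by
  have hsub : hessEigenvalues M g f x ⊆ rayleighValues M g f x := by
    rintro r ⟨η, hη, hη0, hr⟩
    refine ⟨η, hη, hη0, ?_⟩
    rw [hr, map_smul, smul_eq_mul, mul_div_cancel_right₀ _ (hpos η hη0).ne']
  have hlow : L ∈ lowerBounds (rayleighValues M g f x) := by
    rintro r ⟨η, hη, hη0, rfl⟩
    exact (le_div_iff₀ (hpos η hη0)).2 (hbL η hη)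
  have hup : K ∈ upperBounds (rayleighValues M g f x) := by
    rintro r ⟨η, hη, hη0, rfl⟩
    exact (div_le_iff₀ (hpos η hη0)).2 (hbK η hη)
  have h1 : IsGreatest (rayleighValues M g f x) K := ⟨hsub hK, hup⟩
  have h2 : IsLeast (rayleighValues M g f x) L := ⟨hsub hL, hlow⟩
  have h3 : IsGreatest (hessEigenvalues M g f x) K := ⟨hK, fun r hr => hup (hsub hr)⟩
  have h4 : IsLeast (hessEigenvalues M g f x) L := ⟨hL, fun r hr => hlow (hsub hr)⟩
  rw [condNumber, h1.csSup_eq, h2.csInf_eq, h3.csSup_eq, h4.csInf_eq]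
  exact ⟨rfl, rfl⟩

end EmbeddedRiem

/-! ### Candidate eigenvalues and sharp bounds -/

namespace CCA

/-- The candidate eigenvalues of the Hessian with sign `e`. -/
def candidates {m : ℕ} (mu s : Fin m → ℝ) (sigma : ℕ → ℝ) (e : ℝ) : Set ℝ :=
  {r | ∃ i j : Fin m, i ≠ j ∧ r = (mu i + e * mu j) * (sigma i + e * sigma j) / (s i + s j)} ∪
    {r | ∃ i : Fin m, r = mu i * (sigma i + e * sigma m) / s i}

theorem candidates_finite {m : ℕ} (mu s : Fin m → ℝ) (sigma : ℕ → ℝ) (e : ℝ) :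
    (candidates mu s sigma e).Finite := by
  refine Set.Finite.union ?_ ?_
  · refine (Set.finite_range fun q : Fin m × Fin m =>
      (mu q.1 + e * mu q.2) * (sigma q.1 + e * sigma q.2) / (s q.1 + s q.2)).subset ?_
    rintro r ⟨i, j, -, rfl⟩
    exact ⟨(i, j), rfl⟩
  · refine (Set.finite_range fun i : Fin m => mu i * (sigma i + e * sigma m) / s i).subset ?_
    rintro r ⟨i, rfl⟩
    exact ⟨i, rfl⟩

/-- The witness is of exchange type, since the rotation family is empty for `m = 1`. -/
theorem candidates_nonempty {m : ℕ} (hm : 1 ≤ m) (mu s : Fin m → ℝ) (sigma : ℕ → ℝ) (e : ℝ) :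
    (candidates mu s sigma e).Nonempty :=
  ⟨_, Or.inr ⟨⟨0, hm⟩, rfl⟩⟩

section Spectrum

variable {dx dy m : ℕ} {A : Matrix (Fin dx) (Fin dy) ℝ} {P : Matrix (Fin dx) (Fin m) ℝ}
  {Q : Matrix (Fin dy) (Fin m) ℝ} {mu s : Fin m → ℝ}

/-- Every candidate is an eigenvalue in whitened coordinates. -/
theorem IsLeadingSingularVectors.exists_eigenvector (h : IsLeadingSingularVectors A P Q)
    (hanti : ∀ i < m, sval A (i + 1) < sval A i) (hm : m < dy) (hs : ∀ i, 0 < s i) {e r : ℝ}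
    (he : e ^ 2 = 1) (hr : r ∈ candidates mu s (sval A) e) :
    ∃ (a : Fin m → Fin dx → ℝ) (b : Fin m → Fin dy → ℝ), (a ≠ 0 ∨ b ≠ 0) ∧ IsSkewAgainst P a ∧
      IsSkewAgainst Q b ∧ ∀ a' b', IsSkewAgainst P a' → IsSkewAgainst Q b' →
        hessForm A mu (fun i => sval A i) a a' b b' = r * metricForm s a a' b b' := by
  rcases hr with ⟨i, j, hij, rfl⟩ | ⟨i, rfl⟩
  · obtain ⟨a, b, h0, h1, h2, h3⟩ := h.exists_rotation (mu := mu) (s := s) hij he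
      (div_mul_cancel₀ _ (add_pos (hs i) (hs j)).ne')
    exact ⟨a, b, Or.inl h0, h1, h2, h3⟩
  · obtain ⟨a, b, h0, h1, h2, h3⟩ := h.exists_exchange (mu := mu) (s := s) hanti hm i he
      (div_mul_cancel₀ _ (hs i).ne')
    exact ⟨a, b, Or.inr h0, h1, h2, fun a' b' _ _ => h3 a' b'⟩

theorem IsLeadingSingularVectors.sInf_mul_le (h : IsLeadingSingularVectors A P Q)
    (hanti : ∀ i < m, sval A (i + 1) < sval A i) (hmu : ∀ i, 0 < mu i) (hs : ∀ i, 0 < s i)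
    {a : Fin m → Fin dx → ℝ} {b : Fin m → Fin dy → ℝ} (ha : IsSkewAgainst P a)
    (hb : IsSkewAgainst Q b) :
    sInf (candidates mu s (sval A) (-1)) * metricForm s a a b b ≤
      hessForm A mu (fun i => sval A i) a a b b := by
  have hle : ∀ r ∈ candidates mu s (sval A) (-1), sInf (candidates mu s (sval A) (-1)) ≤ r :=
    fun r hr => csInf_le (candidates_finite _ _ _ _).bddBelow hr
  have h1 := h.form_nonneg (s := s) hanti hmu ha hb (K := sInf (candidates mu s (sval A) (-1)))
    (e := -1) (by norm_num)
    (fun i j hij => by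
      have := (le_div_iff₀ (add_pos (hs i) (hs j))).1 (hle _ (Or.inl ⟨i, j, hij, rfl⟩))
      linarith)
    (fun i => by
      have := (le_div_iff₀ (hs i)).1 (hle _ (Or.inr ⟨i, rfl⟩))
      linarith)
  linarith

theorem IsLeadingSingularVectors.le_sSup_mul (h : IsLeadingSingularVectors A P Q)
    (hanti : ∀ i < m, sval A (i + 1) < sval A i) (hmu : ∀ i, 0 < mu i) (hs : ∀ i, 0 < s i)
    {a : Fin m → Fin dx → ℝ} {b : Fin m → Fin dy → ℝ} (ha : IsSkewAgainst P a)
    (hb : IsSkewAgainst Q b) :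
    hessForm A mu (fun i => sval A i) a a b b ≤
      sSup (candidates mu s (sval A) 1) * metricForm s a a b b := by
  have hle : ∀ r ∈ candidates mu s (sval A) 1, r ≤ sSup (candidates mu s (sval A) 1) :=
    fun r hr => le_csSup (candidates_finite _ _ _ _).bddAbove hr
  have h1 := h.form_nonneg (s := s) hanti hmu ha hb (K := sSup (candidates mu s (sval A) 1))
    (e := 1) (by norm_num)
    (fun i j hij => by
      have := (div_le_iff₀ (add_pos (hs i) (hs j))).1 (hle _ (Or.inl ⟨i, j, hij, rfl⟩))
      linarith)
    (fun i => by
      have := (div_le_iff₀ (hs i)).1 (hle _ (Or.inr ⟨i, rfl⟩))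
      linarith)
  linarith

end Spectrum

end CCA

/-! ### The condition number at the canonical correlation solution -/

theorem mainTheorem2 {n dx dy m : ℕ}
    (X : Matrix (Fin n) (Fin dx) ℝ) (Y : Matrix (Fin n) (Fin dy) ℝ)
    (lamx lamy : ℝ) (hlamx : 0 ≤ lamx) (hlamy : 0 ≤ lamy)
    (Sxx : Matrix (Fin dx) (Fin dx) ℝ) (Syy : Matrix (Fin dy) (Fin dy) ℝ)
    (Sxy : Matrix (Fin dx) (Fin dy) ℝ)
    (hSxx : Sxx = CCA.regGram X lamx) (hSyy : Syy = CCA.regGram Y lamy) (hSxy : Sxy = Xᵀ * Y)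
    (hSxx_pd : Sxx.PosDef) (hSyy_pd : Syy.PosDef)
    (hm : 1 ≤ m) (hmx : m < dx) (hmy : m < dy)
    (mu : Fin m → ℝ) (hmu : StrictAnti mu) (hmu_pos : ∀ i, 0 < mu i)
    (delta : ℝ) (hdelta : 0 < delta)
    (sigma : ℕ → ℝ) (hsigma : sigma = CCA.sval (CCA.whitened Sxx Syy Sxy))
    (hsigma_anti : ∀ i < m, sigma (i + 1) < sigma i)
    (Ubar : Matrix (Fin dx) (Fin m) ℝ) (Vbar : Matrix (Fin dy) (Fin m) ℝ)
    (hUV : CCA.IsLeadingSingularVectors (CCA.whitened Sxx Syy Sxy) Ubar Vbar)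
    (M : Set (Matrix (Fin dx) (Fin m) ℝ × Matrix (Fin dy) (Fin m) ℝ))
    (hM : M = CCA.genStiefel m Sxx ×ˢ CCA.genStiefel m Syy)
    (g : Matrix (Fin dx) (Fin m) ℝ × Matrix (Fin dy) (Fin m) ℝ →
      LinearMap.BilinForm ℝ (Matrix (Fin dx) (Fin m) ℝ × Matrix (Fin dy) (Fin m) ℝ))
    (hg : g = CCA.newMetric Sxx Syy Sxy mu delta)
    (f : Matrix (Fin dx) (Fin m) ℝ × Matrix (Fin dy) (Fin m) ℝ → ℝ)
    (hf : f = CCA.cost Sxy mu)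
    (p : Matrix (Fin dx) (Fin m) ℝ × Matrix (Fin dy) (Fin m) ℝ)
    (hp : p = ((CCA.msqrt Sxx)⁻¹ * Ubar, (CCA.msqrt Syy)⁻¹ * Vbar))
    (kappa : ℝ)
    (hkappa : kappa =
      sSup ({r | ∃ i j : Fin m, i ≠ j ∧ r = (mu i + mu j) * (sigma i + sigma j) /
            (√(mu i ^ 2 * sigma i ^ 2 + delta) + √(mu j ^ 2 * sigma j ^ 2 + delta))} ∪
          {r | ∃ i : Fin m, r = mu i * (sigma i + sigma m) / √(mu i ^ 2 * sigma i ^ 2 + delta)}) /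
      sInf ({r | ∃ i j : Fin m, i ≠ j ∧ r = (mu i - mu j) * (sigma i - sigma j) /
            (√(mu i ^ 2 * sigma i ^ 2 + delta) + √(mu j ^ 2 * sigma j ^ 2 + delta))} ∪
          {r | ∃ i : Fin m, r = mu i * (sigma i - sigma m) / √(mu i ^ 2 * sigma i ^ 2 + delta)})) :
    (∀ η ∈ EmbeddedRiem.tangentSpace M p, ∃! w, EmbeddedRiem.IsRiemHess M g f p η w) ∧
    EmbeddedRiem.condNumber M g f p = kappa ∧
    sSup (EmbeddedRiem.rayleighValues M g f p) / sInf (EmbeddedRiem.rayleighValues M g f p)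
      = kappa := by

  subst hsigma hM hg hf hp
  set A := CCA.whitened Sxx Syy Sxy with hA
  set p : Matrix (Fin dx) (Fin m) ℝ × Matrix (Fin dy) (Fin m) ℝ :=
    ((CCA.msqrt Sxx)⁻¹ * Ubar, (CCA.msqrt Syy)⁻¹ * Vbar) with hp
  set M := CCA.genStiefel m Sxx ×ˢ CCA.genStiefel m Syy with hM
  set g := CCA.newMetric Sxx Syy Sxy mu delta with hg
  set s : Fin m → ℝ := fun i => √(mu i ^ 2 * CCA.sval A i ^ 2 + delta) with hs
  have hs_pos : ∀ i, 0 < s i := fun i => Real.sqrt_pos.2 (by positivity)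
  have hpM : p ∈ M := ⟨CCA.msqrt_inv_mul_mem_genStiefel hSxx_pd hUV.1,
    CCA.msqrt_inv_mul_mem_genStiefel hSyy_pd hUV.2.1⟩
  have hproj := CCA.isTangentProj_prodProj (m := m) hSxx_pd hSyy_pd
  have hpos : ∀ q ξ, ξ ≠ 0 → 0 < g q ξ ξ :=
    CCA.newMetric_pos (m := m) hSxx_pd hSyy_pd Sxy mu hdelta
  have hsymm : ∀ q ξ η, g q ξ η = g q η ξ :=
    CCA.newMetric_symm (m := m) hSxx_pd hSyy_pd Sxy mu hdelta
  have htan := CCA.mem_tangentSpace_iff hSxx_pd hSyy_pd hpM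
  have hskew : ∀ ξ, ξ ∈ EmbeddedRiem.tangentSpace M p ↔
      CCA.IsSkewAgainst Ubar (CCA.msqrt Sxx * ξ.1)ᵀ ∧
        CCA.IsSkewAgainst Vbar (CCA.msqrt Syy * ξ.2)ᵀ := fun ξ =>
    (htan ξ).trans (and_congr (CCA.symPart_whiten_eq_zero_iff hSxx_pd Ubar ξ.1)
      (CCA.symPart_whiten_eq_zero_iff hSyy_pd Vbar ξ.2))
  have hmain := fun η (hη : η ∈ EmbeddedRiem.tangentSpace M p) =>
    EmbeddedRiem.hessian_at_critical hproj (CCA.contDiff_newMetric Sxy mu hdelta) hsymm hpos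
      (CCA.contDiff_cost Sxy mu) hpM (fun η hη => CCA.fderiv_cost_eq_zero hSxx_pd hSyy_pd hUV mu
        ((htan η).1 hη).1 ((htan η).1 hη).2) hη
  have hform : ∀ η ∈ EmbeddedRiem.tangentSpace M p, ∀ ζ ∈ EmbeddedRiem.tangentSpace M p,
      g p (EmbeddedRiem.riemHess M g (CCA.cost Sxy mu) p η) ζ =
        CCA.hessForm A mu (fun i => CCA.sval A i) (CCA.msqrt Sxx * η.1)ᵀ (CCA.msqrt Sxx * ζ.1)ᵀ
          (CCA.msqrt Syy * η.2)ᵀ (CCA.msqrt Syy * ζ.2)ᵀ := fun η hη ζ hζ =>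
    ((hmain η hη).2.2 ζ hζ).trans (CCA.hessian_whiten hSxx_pd hSyy_pd hUV mu ((htan ζ).1 hζ).1
      ((htan ζ).1 hζ).2)
  have hmet : ∀ η ζ, g p η ζ = CCA.metricForm s (CCA.msqrt Sxx * η.1)ᵀ (CCA.msqrt Sxx * ζ.1)ᵀ
      (CCA.msqrt Syy * η.2)ᵀ (CCA.msqrt Syy * ζ.2)ᵀ := fun η ζ =>
    CCA.newMetric_whiten hSxx_pd hSyy_pd hUV mu hdelta η ζ
  have heig : ∀ e r : ℝ, e ^ 2 = 1 → r ∈ CCA.candidates mu s (CCA.sval A) e →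
      r ∈ EmbeddedRiem.hessEigenvalues M g (CCA.cost Sxy mu) p := by
    intro e r he hr
    obtain ⟨a, b, h0, ha, hb, hab⟩ := hUV.exists_eigenvector hsigma_anti hmy hs_pos he hr
    let η : Matrix (Fin dx) (Fin m) ℝ × Matrix (Fin dy) (Fin m) ℝ :=
      ((CCA.msqrt Sxx)⁻¹ * (Matrix.of a)ᵀ, (CCA.msqrt Syy)⁻¹ * (Matrix.of b)ᵀ)
    have hηa : (CCA.msqrt Sxx * η.1)ᵀ = a := by
      simp only [η]
      rw [← Matrix.mul_assoc, CCA.msqrt_mul_inv hSxx_pd, Matrix.one_mul, Matrix.transpose_transpose]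
      rfl
    have hηb : (CCA.msqrt Syy * η.2)ᵀ = b := by
      simp only [η]
      rw [← Matrix.mul_assoc, CCA.msqrt_mul_inv hSyy_pd, Matrix.one_mul, Matrix.transpose_transpose]
      rfl
    have hη : η ∈ EmbeddedRiem.tangentSpace M p := by
      rw [hskew, hηa, hηb]
      exact ⟨ha, hb⟩
    refine ⟨η, hη, ?_, ?_⟩
    · intro hη0
      rw [hη0] at hηa hηb
      rcases h0 with h0 | h0
      · exact h0 (hηa.symm.trans (by rw [Prod.fst_zero, Matrix.mul_zero]; rfl))
      · exact h0 (hηb.symm.trans (by rw [Prod.snd_zero, Matrix.mul_zero]; rfl))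
    -- The eigenvector identity is known only against tangent vectors. The defect w = Hess η - rη is
    -- itself tangent, so testing against w gives g(w, w) = 0.
    · by_contra hne
      have hmem := hproj.sub_mem hpM (hmain η hη).2.1 (hproj.smul_mem hpM hη r)
      have h1 := hpos p _ (sub_ne_zero.2 hne)
      rw [LinearMap.map_sub₂, LinearMap.map_smul₂, hform η hη _ hmem, hmet, hηa, hηb,
        hab _ _ ((hskew _).1 hmem).1 ((hskew _).1 hmem).2, smul_eq_mul, sub_self] at h1
      exact h1.false
  have hκ : kappa = sSup (CCA.candidates mu s (CCA.sval A) 1) /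
      sInf (CCA.candidates mu s (CCA.sval A) (-1)) := by
    rw [hkappa]
    simp only [CCA.candidates, hs, one_mul, neg_mul, ← sub_eq_add_neg]
  rw [hκ]
  -- The candidate sets are finite and nonempty, so their infimum and supremum are themselves
  -- candidates and hence eigenvalues.
  refine ⟨fun η hη => (hmain η hη).1, EmbeddedRiem.condNumber_eq_of_extreme (hpos p)
    (heig (-1) _ (by norm_num) ((CCA.candidates_nonempty hm _ _ _ _).csInf_mem
      (CCA.candidates_finite _ _ _ _)))
    (heig 1 _ (by norm_num) ((CCA.candidates_nonempty hm _ _ _ _).csSup_mem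
      (CCA.candidates_finite _ _ _ _))) (fun η hη => ?_) fun η hη => ?_⟩
  · rw [hsymm p η (EmbeddedRiem.riemHess _ _ _ _ _), hform η hη η hη, hmet]
    exact hUV.sInf_mul_le hsigma_anti hmu_pos hs_pos ((hskew η).1 hη).1 ((hskew η).1 hη).2
  · rw [hsymm p η (EmbeddedRiem.riemHess _ _ _ _ _), hform η hη η hη, hmet]
    exact hUV.le_sSup_mul hsigma_anti hmu_pos hs_pos ((hskew η).1 hη).1 ((hskew η).1 hη).2
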